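/- Let $\lambda_b,\lambda_u,P_b,\theta>0$, $\alpha>2$ and $\sigma_n^2\ge 0$. Base stations (BSs) form a homogeneous Poisson point process $\Phi_b$ of intensity $\lambda_b$ on $\mathbb{R}^2$, and all of them transmit with power $P_b$. A tagged user at the origin is served by its nearest BS $b_o$, at distance $R$, and receives the interference $$I=P_b\sum_{b\in\Phi_b\setminus\{b_o\}}g_b\,|b|^{-\alpha},$$ where the fading gains $g_b$ are i.i.d. exponential with mean $1$ (Rayleigh fading). The cell of $b_o$ contains $N$ other users, where (approximate model of the user counts) $N$ has, with $c=7/2$, the probability mass function $$f_N(n)=\frac{\Gamma(n+c+1)\left(\frac{\lambda_u}{c\lambda_b}\right)^n}{\Gamma(n+1)\,\Gamma(c+1)\left(\frac{\lambda_u}{c\lambda_b}+1\right)^{n+c+1}},\qquad n=0,1,2,\dots$$ The fading gains $h_1,h_2,\dots$ of the users of the cell are i.i.d. exponential with mean $1$, and $N$, $\Phi_b$, $(g_b)$, $(h_i)$ are independent. The BS serves, among the $N+1$ users of its cell (at arbitrary positive distances), one with the largest instantaneous SNR divided by its short-term average SNR (the mean over the fading at fixed distance; for $\sigma_n^2=0$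 the quotient is read as that of the received powers); the gain of this user is the largest of $h_1,\dots,h_{N+1}$, denoted $h_{N+1:N+1}$. When the tagged user is scheduled, its SINR is $$\mathit{SINR}=\frac{P_b\,h_{N+1:N+1}\,R^{-\alpha}}{\sigma_n^2+I}.$$ Then the interference series converges almost surely, the integrals and the series over $n$ below converge, and the coverage probability is $$\mathbb{P}(\mathit{SINR}>\theta)=\pi\lambda_b\sum_{n=0}^{\infty}f_N(n)\sum_{k=1}^{n+1}\binom{n+1}{k}(-1)^{k+1}\int_0^\infty \exp\!\left(-\pi\lambda_b v\,(1+\rho(k\theta,\alpha))-\frac{k\,v^{\alpha/2}\,\theta\,\sigma_n^2}{P_b}\right)dv,$$ where $$\rho(k\theta,\alpha)=(k\theta)^{2/\alpha}\int_{(k\theta)^{-2/\alpha}}^{\infty}\frac{du}{1+u^{\alpha/2}}.$$ -/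

import Mathlib

open MeasureTheory ProbabilityTheory Set

noncomputable section

namespace Cellular

/-- The Euclidean plane. -/
abbrev Plane : Type := EuclideanSpace ℝ (Fin 2)

/-- The number of points of the enumerated configuration `x 0, x 1, …` that lie in `A`. -/
def pointCount (x : ℕ → Plane) (A : Set Plane) : ℕ∞ := {i : ℕ | x i ∈ A}.encard

/-- `X 0, X 1, …` is a measurable enumeration, almost surely without repetition, of a
homogeneous Poisson point process of intensity `lam` on the plane: the number of points in a
bounded Borel set `A` is Poisson with mean `lam * area A`, and the numbers of points in finitely
many pairwise disjoint bounded Borel sets are independent. (For `lam > 0` the process has almost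
surely infinitely many points, so that an enumeration by `ℕ` is no restriction.) -/
structure IsHomogeneousPPP {Ω : Type*} [MeasurableSpace Ω] (μ : Measure Ω) (lam : ℝ)
    (X : ℕ → Ω → Plane) : Prop where
  measurable : ∀ i, Measurable (X i)
  injective : ∀ᵐ ω ∂μ, Function.Injective fun i => X i ω
  count_law : ∀ A : Set Plane, MeasurableSet A → Bornology.IsBounded A → ∀ k : ℕ,
    μ.real {ω | pointCount (fun i => X i ω) A = (k : ℕ∞)} =
      Real.exp (-(lam * volume.real A)) * (lam * volume.real A) ^ k / (k.factorial : ℝ)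
  count_indep : ∀ (m : ℕ) (A : Fin m → Set Plane), (∀ j, MeasurableSet (A j)) →
    (∀ j, Bornology.IsBounded (A j)) → Pairwise (fun i j => Disjoint (A i) (A j)) →
    iIndepFun (fun j ω => pointCount (fun i => X i ω) (A j)) μ

/-- Rayleigh fading: the power gains are i.i.d. exponential random variables of mean one. -/
structure IsRayleigh {Ω : Type*} [MeasurableSpace Ω] (μ : Measure Ω)
    (g : ℕ → Ω → ℝ) : Prop where
  measurable : ∀ i, Measurable (g i)
  law : ∀ i, μ.map (g i) = expMeasure 1
  indep : iIndepFun g μ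

/-- Distance from the tagged user, at the origin, to the nearest base station. -/
def nearestDist (x : ℕ → Plane) : ℝ := ⨅ i, ‖x i‖

open Classical in
/-- Interference received at the origin when every base station `x i` transmits with power `P`,
has the fading gain `g i` and path loss exponent `α`: the nearest base station, which serves the
tagged user, is left out of the sum. -/
def interference (P α : ℝ) (x : ℕ → Plane) (g : ℕ → ℝ) : ℝ :=
  P * ∑' i : ℕ, if ‖x i‖ = nearestDist x then 0 else g i * ‖x i‖ ^ (-α)

/-- Instantaneous received power, for fading gain `h` and distance `r`. -/
def rxPower (P α r h : ℝ) : ℝ := P * h * r ^ (-α)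

/-- Instantaneous SNR divided by the short-term average SNR, that is by the mean SNR over the
fading at a fixed distance. The noise power cancels from this quotient, so it is written with
received powers, which keeps it meaningful for zero noise. -/
def normalizedSNR (P α r h : ℝ) : ℝ :=
  rxPower P α r h / ∫ y, rxPower P α r y ∂(expMeasure 1)

/-- Normalized SNR scheduling among the `n + 1` users `0, …, n` of a cell, at distances `r i` from
their base station and with fading gains `h i`: a user with the largest normalized SNR. -/
def scheduledUser (P α : ℝ) (n : ℕ) (r h : ℕ → ℝ) : ℕ :=
  (Finset.exists_max_image (Finset.range (n + 1)) (fun i => normalizedSNR P α (r i) (h i))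
    ⟨0, by simp⟩).choose

/-- SINR of the tagged user when it is scheduled: `x` base stations, `g` gains of the interfering
signals, `n` number of other users in the cell, `r` and `h` distances and gains of the `n + 1` users
of the cell, `σ ^ 2` noise power. When it is scheduled, the tagged user has the gain of the
scheduled user, and its distance to its base station is `nearestDist x`. -/
def SINR (P α σ : ℝ) (x : ℕ → Plane) (g : ℕ → ℝ) (n : ℕ) (r h : ℕ → ℝ) : ℝ :=
  rxPower P α (nearestDist x) (h (scheduledUser P α n r h)) /
    (σ ^ 2 + interference P α x g)

/-- The probability mass function of the number of other users in the cell of the tagged user,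
with `c = 7 / 2`. -/
def fN (lamb lamu : ℝ) (n : ℕ) : ℝ :=
  let c : ℝ := 7 / 2
  Real.Gamma (n + c + 1) * (lamu / (c * lamb)) ^ n /
    (Real.Gamma (n + 1) * Real.Gamma (c + 1) * (lamu / (c * lamb) + 1) ^ ((n : ℝ) + c + 1))

/-- `ρ(t, α) = t^(2/α) ∫_{t^(-2/α)}^∞ du / (1 + u^(α/2))`. -/
def rho (t α : ℝ) : ℝ :=
  t ^ (2 / α) * ∫ u in Ioi (t ^ (-2 / α)), 1 / (1 + u ^ (α / 2))

/-- The integrand, in `v`, of the `k`-th term of the coverage probability. -/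
def covIntegrand (lamb P α σ θ : ℝ) (k : ℕ) (v : ℝ) : ℝ :=
  Real.exp (-(Real.pi * lamb * v * (1 + rho (k * θ) α)) - k * v ^ (α / 2) * θ * σ ^ 2 / P)

/-- The `n`-th term of the coverage probability, without the factor `π λ_b`. -/
def covTerm (lamb lamu P α σ θ : ℝ) (n : ℕ) : ℝ :=
  fN lamb lamu n * ∑ k ∈ Finset.Icc 1 (n + 1),
    ((n + 1).choose k : ℝ) * (-1) ^ (k + 1) * ∫ v in Ioi (0 : ℝ), covIntegrand lamb P α σ θ k v

end Cellular

end

/-! Write `V` for the squared distance of the nearest base station and `m = π λ_b`. Dividing the SNR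
by its fading mean leaves the gain itself, so the scheduled user has the maximum of `n + 1` unit
exponentials (`gain_scheduledUser`), and coverage means that this maximum exceeds `s = θ (σ² + I)
R^α / P` (`SINR_gt_iff`). Given `s` this has probability `1 - (1 - e^{-s})^{n+1}`, whose binomial
expansion is the alternating sum over `k`. It remains to compute `E e^{-ks}`. Averaging over the
interfering gains first replaces the interference by `exp (-∑ log (1 + kθ (V/|x|²)^{α/2}))`, summed
over the points farther than the nearest one (`integral_exp_requiredGain`), and what is left is an
expectation over the point process alone (`integral_nearest`).

That expectation is found without conditioning on the nearest point. The count laws give the Laplace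
functional (`integral_negExp_tsum`), and since its test function may take the value `∞`, void events
are included. On a thin strip `a ≤ V < b` the integrand is squeezed between differences of Laplace
functionals of explicit radial functions (`negExp_interferenceExponent_le`,
`le_negExp_interferenceExponent`). After integration both bounds are `m (b - a) K` to first order in
`b - a`, where `K v = G v * exp (-m v (1 + ρ))` and `G` is the noise factor. Hence the integral over
`V < a` has right derivative `m K a`, and the fundamental theorem of calculus yields `m ∫ K`
(`integral_eq_of_strip_bounds`).

Finally the independent `N` is summed out. The degenerate cases (infinite or zero interference, a
point at the origin) are null events, again by Laplace functionals. -/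

noncomputable section

namespace Cellular

open Filter Topology ENNReal

/-! ### Laplace functional of a Poisson process from its count laws -/

section

/-- The function `x ↦ exp (-x)` on `[0, ∞]`, with value `0` at `∞`. -/
def negExp (x : ℝ≥0∞) : ℝ := (EReal.exp (-(x : EReal))).toReal

lemma exp_neg_coe_le_one (x : ℝ≥0∞) : EReal.exp (-(x : EReal)) ≤ 1 := by
  rw [EReal.exp_le_one_iff, EReal.neg_le, neg_zero]
  exact EReal.coe_ennreal_nonneg x

lemma exp_neg_coe_ne_top (x : ℝ≥0∞) : EReal.exp (-(x : EReal)) ≠ ∞ :=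
  ((exp_neg_coe_le_one x).trans_lt one_lt_top).ne

lemma negExp_nonneg (x : ℝ≥0∞) : 0 ≤ negExp x := toReal_nonneg

lemma negExp_le_one (x : ℝ≥0∞) : negExp x ≤ 1 := by
  simpa [negExp] using toReal_mono one_ne_top (exp_neg_coe_le_one x)

@[simp] lemma negExp_zero : negExp 0 = 1 := by simp [negExp]

@[simp] lemma negExp_top : negExp ∞ = 0 := by simp [negExp]

lemma negExp_coe {x : ℝ≥0∞} (hx : x ≠ ∞) : negExp x = Real.exp (-x.toReal) := by
  lift x to NNReal using hx
  simp only [negExp, coe_toReal]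
  have : (-((x : ℝ≥0∞) : EReal)) = ((-(x : ℝ) : ℝ) : EReal) := by
    rw [EReal.coe_neg]; rfl
  rw [this, EReal.exp_coe, toReal_ofReal (Real.exp_pos _).le]

lemma negExp_ofReal {x : ℝ} (hx : 0 ≤ x) : negExp (ENNReal.ofReal x) = Real.exp (-x) := by
  rw [negExp_coe ofReal_ne_top, toReal_ofReal hx]

lemma negExp_add (x y : ℝ≥0∞) : negExp (x + y) = negExp x * negExp y := by
  rcases eq_or_ne x ∞ with rfl | hx
  · simp
  rcases eq_or_ne y ∞ with rfl | hy
  · simp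
  rw [negExp_coe hx, negExp_coe hy, negExp_coe (add_ne_top.2 ⟨hx, hy⟩), toReal_add hx hy, neg_add,
    Real.exp_add]

lemma negExp_sum {ι : Type*} (s : Finset ι) (f : ι → ℝ≥0∞) :
    negExp (∑ i ∈ s, f i) = ∏ i ∈ s, negExp (f i) := by
  classical
  induction s using Finset.induction_on with
  | empty => simp
  | insert a s ha ih => rw [Finset.sum_insert ha, Finset.prod_insert ha, negExp_add, ih]

lemma negExp_mul_nat (x : ℝ≥0∞) (k : ℕ) : negExp (x * k) = negExp x ^ k := by
  have := negExp_sum (Finset.range k) fun _ => x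
  simpa [mul_comm] using this

lemma negExp_antitone : Antitone negExp := fun x y h => by
  refine toReal_mono (exp_neg_coe_ne_top x) (EReal.exp_monotone ?_)
  exact EReal.neg_le_neg_iff.2 (EReal.coe_ennreal_le_coe_ennreal_iff.2 h)

lemma continuous_negExp : Continuous negExp := by
  refine continuousOn_toReal.comp_continuous ?_ exp_neg_coe_ne_top
  exact EReal.expHomeomorph.continuous.comp
    (continuous_neg.comp continuous_coe_ennreal_ereal)

lemma measurable_negExp : Measurable negExp := continuous_negExp.measurable

lemma integrable_negExp {Ω : Type*} [MeasurableSpace Ω] {μ : Measure Ω} [IsFiniteMeasure μ]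
    {f : Ω → ℝ≥0∞} (hf : Measurable f) : Integrable (fun ω => negExp (f ω)) μ :=
  Integrable.of_bound (measurable_negExp.comp hf).aestronglyMeasurable 1
    (ae_of_all _ fun ω => by
      rw [Real.norm_of_nonneg (negExp_nonneg _)]; exact negExp_le_one _)

/-- Continuity of the expectation of `exp (-f n)` along pointwise convergent sequences. -/
lemma tendsto_integral_negExp {Ω : Type*} [MeasurableSpace Ω] {μ : Measure Ω} [IsFiniteMeasure μ]
    {f : ℕ → Ω → ℝ≥0∞} {g : Ω → ℝ≥0∞} (hf : ∀ n, Measurable (f n))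
    (h : ∀ᵐ ω ∂μ, Tendsto (fun n => f n ω) atTop (𝓝 (g ω))) :
    Tendsto (fun n => ∫ ω, negExp (f n ω) ∂μ) atTop (𝓝 (∫ ω, negExp (g ω) ∂μ)) := by
  refine tendsto_integral_of_dominated_convergence (fun _ => 1)
    (fun n => (measurable_negExp.comp (hf n)).aestronglyMeasurable) (integrable_const _)
    (fun n => ae_of_all _ fun ω => ?_) ?_
  · rw [Real.norm_of_nonneg (negExp_nonneg _)]; exact negExp_le_one _
  · filter_upwards [h] with ω hω using (continuous_negExp.tendsto _).comp hω

lemma pointCount_eq_tsum (x : ℕ → Plane) (A : Set Plane) :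
    ((pointCount x A : ℕ∞) : ℝ≥0∞) = ∑' i, A.indicator (fun _ => 1) (x i) := by
  rw [pointCount, ← tsum_set_one, tsum_subtype {i | x i ∈ A} fun _ => (1 : ℝ≥0∞)]
  rfl

variable {Ω : Type*} [MeasurableSpace Ω] {μ : Measure Ω} {lam : ℝ} {X : ℕ → Ω → Plane}

lemma measurable_tsum_comp (hX : ∀ i, Measurable (X i)) {u : Plane → ℝ≥0∞} (hu : Measurable u) :
    Measurable fun ω => ∑' i, u (X i ω) :=
  Measurable.tsum fun i => hu.comp (hX i)

lemma measurable_pointCount (hX : ∀ i, Measurable (X i)) {A : Set Plane} (hA : MeasurableSet A) :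
    Measurable fun ω => pointCount (fun i => X i ω) A := by
  refine measurable_to_countable' fun k => ?_
  have h : Measurable fun ω => ((pointCount (fun i => X i ω) A : ℕ∞) : ℝ≥0∞) := by
    simp_rw [pointCount_eq_tsum]
    exact measurable_tsum_comp hX (measurable_const.indicator hA)
  have := h (measurableSet_singleton ((k : ℕ∞) : ℝ≥0∞))
  convert! this using 1
  ext ω
  simp

/-- Probability generating function of the number of points in a bounded set. -/
lemma IsHomogeneousPPP.integral_negExp_count [IsProbabilityMeasure μ]
    (h : IsHomogeneousPPP μ lam X) {A : Set Plane} (hA : MeasurableSet A)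
    (hb : Bornology.IsBounded A) (c : ℝ≥0∞) :
    ∫ ω, negExp (c * (pointCount (fun i => X i ω) A : ℕ∞)) ∂μ =
      Real.exp (-(lam * volume.real A * (1 - negExp c))) := by
  set N : Ω → ℕ∞ := fun ω => pointCount (fun i => X i ω) A with hNdef
  have hN : Measurable N := measurable_pointCount h.measurable hA
  set m := lam * volume.real A
  have hlaw : ∀ k : ℕ, μ.real {ω | N ω = k} = Real.exp (-m) * m ^ k / k.factorial :=
    h.count_law A hA hb
  set s : ℕ → Set Ω := fun k => {ω | N ω = k}
  have hs : ∀ k, MeasurableSet (s k) := fun k => hN (measurableSet_singleton _)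
  have hd : Pairwise (Function.onFun Disjoint s) := fun i j hij => by
    refine Set.disjoint_left.2 fun ω h1 h2 => hij ?_
    have : (i : ℕ∞) = j := h1.symm.trans h2
    exact_mod_cast this
  have hexp : ∀ z : ℝ, HasSum (fun k : ℕ => z ^ k * (Real.exp (-m) * m ^ k / k.factorial))
      (Real.exp (-(m * (1 - z)))) := fun z => by
    have := (NormedSpace.expSeries_div_hasSum_exp (𝔸 := ℝ) (z * m)).mul_left (Real.exp (-m))
    rw [← Real.exp_eq_exp_ℝ, ← Real.exp_add] at this
    convert! this using 2
    · rename_i k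
      rw [mul_pow]; ring
    · ring
  have hF : Measurable fun ω => c * ((N ω : ℕ∞) : ℝ≥0∞) :=
    (Measurable.of_discrete (f := fun n : ℕ∞ => c * (n : ℝ≥0∞))).comp hN
  -- The Poisson weights sum to one (`hexp` at `1`), so the value `⊤` of the count, on which
  -- `count_law` is silent, carries no mass.
  have hone : ∫ ω in ⋃ k, s k, (1 : ℝ) ∂μ = 1 := by
    have h1 := hasSum_integral_iUnion (f := fun _ => (1 : ℝ)) hs hd (μ := μ)
      (integrable_const _).integrableOn
    refine h1.unique ?_
    have h2 := hexp 1
    simp only [sub_self, mul_zero, neg_zero, Real.exp_zero, one_pow, one_mul] at h2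
    convert! h2 using 2
    rename_i k
    simpa using hlaw k
  have huniv : (⋃ k, s k) =ᵐ[μ] univ := by
    rw [ae_eq_univ, ← prob_compl_eq_one_iff (MeasurableSet.iUnion hs).compl, compl_compl]
    simp only [integral_const, MeasurableSet.univ, measureReal_restrict_apply, univ_inter,
      smul_eq_mul, mul_one] at hone
    rw [measureReal_def] at hone
    rw [← ENNReal.ofReal_toReal (measure_ne_top μ _), hone, ofReal_one]
  have h1 := hasSum_integral_iUnion (f := fun ω => negExp (c * ((N ω : ℕ∞) : ℝ≥0∞))) hs hd (μ := μ)
    (integrable_negExp hF).integrableOn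
  rw [Measure.restrict_congr_set huniv, Measure.restrict_univ] at h1
  refine h1.unique ?_
  convert! hexp (negExp c) using 2
  rename_i k
  rw [setIntegral_congr_fun (g := fun _ => negExp c ^ k) (hs k)]
  · simp only [integral_const, MeasurableSet.univ, measureReal_restrict_apply, univ_inter,
      smul_eq_mul]
    rw [← hlaw k, mul_comm]
  · intro ω hω
    have hω' : N ω = k := hω
    simp [hω', negExp_mul_nat]

/-- The Laplace functional of a Poisson process at a finite combination of indicators. -/
lemma IsHomogeneousPPP.integral_negExp_sum_indicator [IsProbabilityMeasure μ]
    (h : IsHomogeneousPPP μ lam X) {m : ℕ} {A : Fin m → Set Plane} (hA : ∀ j, MeasurableSet (A j))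
    (hb : ∀ j, Bornology.IsBounded (A j)) (hd : Pairwise fun i j => Disjoint (A i) (A j))
    (c : Fin m → ℝ≥0∞) :
    ∫ ω, negExp (∑' i, ∑ j, (A j).indicator (fun _ => c j) (X i ω)) ∂μ =
      Real.exp (-(lam * ∑ j, volume.real (A j) * (1 - negExp (c j)))) := by
  have h1 : ∀ ω, negExp (∑' i, ∑ j, (A j).indicator (fun _ => c j) (X i ω)) =
      ∏ j, negExp (c j * (pointCount (fun i => X i ω) (A j) : ℕ∞)) := fun ω => by
    rw [← negExp_sum, Summable.tsum_finsetSum fun _ _ => ENNReal.summable]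
    congr 1
    refine Finset.sum_congr rfl fun j _ => ?_
    rw [pointCount_eq_tsum, ← ENNReal.tsum_mul_left]
    refine tsum_congr fun i => ?_
    by_cases hi : X i ω ∈ A j <;> simp [hi]
  simp_rw [h1]
  rw [(h.count_indep m A hA hb hd).integral_fun_prod_comp
    (f := fun j (n : ℕ∞) => negExp (c j * (n : ℝ≥0∞)))
    (fun j => (measurable_pointCount h.measurable (hA j)).aemeasurable)
    (fun j => Measurable.of_discrete.aestronglyMeasurable)]
  simp_rw [fun j => h.integral_negExp_count (hA j) (hb j) (c j)]
  rw [← Real.exp_sum, Finset.sum_neg_distrib, Finset.mul_sum]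
  simp only [mul_assoc]

/-- The Laplace functional of a homogeneous Poisson point process. -/
theorem IsHomogeneousPPP.integral_negExp_tsum [IsProbabilityMeasure μ]
    (h : IsHomogeneousPPP μ lam X) (hlam : 0 ≤ lam) {u : Plane → ℝ≥0∞} (hu : Measurable u) :
    ∫ ω, negExp (∑' i, u (X i ω)) ∂μ =
      negExp (ENNReal.ofReal lam * ∫⁻ x, ENNReal.ofReal (1 - negExp (u x))) := by
  -- Counts are controlled only on bounded sets, so the simple approximations of `u` are also cut
  -- off to growing balls.
  set B : ℕ → Set Plane := fun n => Metric.ball 0 n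
  have hBm : ∀ n, MeasurableSet (B n) := fun n => Metric.isOpen_ball.measurableSet
  set f : ℕ → Plane → ℝ≥0∞ := fun n => (B n).indicator (SimpleFunc.eapprox u n)
  have hf : ∀ n, Measurable (f n) := fun n => (SimpleFunc.measurable _).indicator (hBm n)
  have hmono : Monotone f := fun n k hnk x => by
    refine (indicator_le_indicator_apply_of_subset (Metric.ball_subset_ball (by exact_mod_cast hnk))
      zero_le).trans (indicator_le_indicator (SimpleFunc.monotone_eapprox u hnk x))
  have hlim : ∀ x, Tendsto (fun n => f n x) atTop (𝓝 (u x)) := fun x => by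
    have h1 : Tendsto (fun n => SimpleFunc.eapprox u n x) atTop (𝓝 (u x)) :=
      SimpleFunc.tendsto_eapprox hu x
    refine h1.congr' ?_
    obtain ⟨n, hn⟩ := exists_nat_gt ‖x‖
    filter_upwards [eventually_ge_atTop n] with k hk
    have : x ∈ B k := by
      have hk' : (n : ℝ) ≤ k := by exact_mod_cast hk
      simpa [B] using hn.trans_le hk'
    simp [f, this]
  have hsimple : ∀ n, ∫ ω, negExp (∑' i, f n (X i ω)) ∂μ =
      negExp (ENNReal.ofReal lam * ∫⁻ x, ENNReal.ofReal (1 - negExp (f n x))) := fun n => by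
    set φ := SimpleFunc.eapprox u n
    set e := φ.range.equivFin
    set A : Fin φ.range.card → Set Plane := fun j => B n ∩ φ ⁻¹' {((e.symm j : φ.range) : ℝ≥0∞)}
    have hAm : ∀ j, MeasurableSet (A j) := fun j => (hBm n).inter (φ.measurableSet_fiber _)
    have hAb : ∀ j, Bornology.IsBounded (A j) := fun j =>
      Metric.isBounded_ball.subset inter_subset_left
    have hAd : Pairwise fun i j => Disjoint (A i) (A j) := fun i j hij => by
      refine Set.disjoint_left.2 fun x h1 h2 => hij ?_
      have h3 : ((e.symm i : φ.range) : ℝ≥0∞) = (e.symm j : φ.range) := by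
        rw [← show φ x = _ from h1.2, ← show φ x = _ from h2.2]
      exact e.symm.injective (Subtype.ext h3)
    -- Needed for the identity and for `y ↦ 1 - e^{-y}`. The condition `G 0 = 0` covers the points
    -- outside `B n`, which no `A j` contains.
    have hsum : ∀ (G : ℝ≥0∞ → ℝ≥0∞), G 0 = 0 → ∀ x, G (f n x) =
        ∑ j, (A j).indicator (fun _ => G (e.symm j : φ.range)) x := fun G hG x => by
      by_cases hx : x ∈ B n
      · rw [Finset.sum_eq_single (e ⟨φ x, φ.mem_range_self x⟩)]
        · simp [f, A, hx, φ]
        · intro j _ hj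
          refine indicator_of_notMem (fun hxj => hj ?_) _
          have : φ x = (e.symm j : φ.range) := hxj.2
          rw [show (⟨φ x, φ.mem_range_self x⟩ : φ.range) = e.symm j from Subtype.ext this]
          simp
        · simp
      · simp [f, A, hx, hG]
    have h1 := h.integral_negExp_sum_indicator hAm hAb hAd fun j => (e.symm j : φ.range)
    have h2 : ∀ x, f n x = ∑ j, (A j).indicator (fun _ => ((e.symm j : φ.range) : ℝ≥0∞)) x :=
      hsum id rfl
    simp_rw [← h2] at h1
    rw [h1]
    have h3 := hsum (fun y => ENNReal.ofReal (1 - negExp y)) (by simp)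
    simp_rw [h3]
    rw [lintegral_finsetSum _ fun j _ => measurable_const.indicator (hAm j)]
    simp_rw [lintegral_indicator_const (hAm _)]
    have h4 : ENNReal.ofReal lam * ∑ j, ENNReal.ofReal (1 - negExp (e.symm j : φ.range)) *
        volume (A j) = ENNReal.ofReal
          (lam * ∑ j, volume.real (A j) * (1 - negExp (e.symm j : φ.range))) := by
      rw [ENNReal.ofReal_mul hlam, ENNReal.ofReal_sum_of_nonneg fun j _ =>
        mul_nonneg measureReal_nonneg (sub_nonneg.2 (negExp_le_one _))]
      congr 1
      refine Finset.sum_congr rfl fun j _ => ?_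
      rw [ENNReal.ofReal_mul measureReal_nonneg, measureReal_def,
        ENNReal.ofReal_toReal (hAb j).measure_lt_top.ne, mul_comm]
    rw [h4, negExp_ofReal]
    exact mul_nonneg hlam (Finset.sum_nonneg fun j _ =>
        mul_nonneg measureReal_nonneg (sub_nonneg.2 (negExp_le_one _)))
  have hL : Tendsto (fun n => ∫ ω, negExp (∑' i, f n (X i ω)) ∂μ) atTop
      (𝓝 (∫ ω, negExp (∑' i, u (X i ω)) ∂μ)) := by
    refine tendsto_integral_negExp (fun n => measurable_tsum_comp h.measurable (hf n))
      (ae_of_all _ fun ω => ?_)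
    simp_rw [← lintegral_count]
    exact lintegral_tendsto_of_tendsto_of_monotone (fun n => Measurable.of_discrete.aemeasurable)
      (ae_of_all _ fun i n k hnk => hmono hnk _) (ae_of_all _ fun i => hlim _)
  have hR : Tendsto (fun n => negExp (ENNReal.ofReal lam *
        ∫⁻ x, ENNReal.ofReal (1 - negExp (f n x)))) atTop
      (𝓝 (negExp (ENNReal.ofReal lam * ∫⁻ x, ENNReal.ofReal (1 - negExp (u x))))) := by
    refine (continuous_negExp.tendsto _).comp
      (ENNReal.Tendsto.const_mul ?_ (Or.inr ofReal_ne_top))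
    refine lintegral_tendsto_of_tendsto_of_monotone (fun n => ?_)
      (ae_of_all _ fun x n k hnk => ?_) (ae_of_all _ fun x => ?_)
    · exact (measurable_const.sub (measurable_negExp.comp (hf n))).ennreal_ofReal.aemeasurable
    · exact ENNReal.ofReal_le_ofReal (sub_le_sub_left (negExp_antitone (hmono hnk x)) _)
    · exact ENNReal.tendsto_ofReal
        (tendsto_const_nhds.sub ((continuous_negExp.tendsto _).comp (hlim x)))
  exact tendsto_nhds_unique hL (by simpa only [hsimple] using hR)

end

/-! ### Radial test functions and the integral `rho` -/

section

/-- The squared norm maps the area measure to `π` times the length measure on `[0, ∞)`. -/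
lemma map_norm_sq_volume : (volume : Measure Plane).map (fun x => ‖x‖ ^ 2) =
    ENNReal.ofReal Real.pi • (volume : Measure ℝ).restrict (Ioi 0) := by
  have hm : Measurable fun x : Plane => ‖x‖ ^ 2 := by fun_prop
  have hpre : ∀ {b : ℝ}, 0 ≤ b → (fun x : Plane => ‖x‖ ^ 2) ⁻¹' Iio b = Metric.ball 0 (√b) :=
    fun {b} hb => by
      ext x
      simp [Real.lt_sqrt (norm_nonneg x)]
  have hball : ∀ {b : ℝ}, 0 ≤ b → volume (Metric.ball (0 : Plane) (√b)) =
      ENNReal.ofReal (Real.pi * b) := fun {b} hb => by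
    rw [EuclideanSpace.volume_ball_fin_two, ← ENNReal.ofReal_pow (Real.sqrt_nonneg _),
      Real.sq_sqrt hb, mul_comm, ENNReal.ofReal_mul Real.pi_pos.le]
  have : IsLocallyFiniteMeasure
      (ENNReal.ofReal Real.pi • (volume : Measure ℝ).restrict (Ioi 0)) :=
    ⟨fun x => ⟨Ioo (x - 1) (x + 1), Ioo_mem_nhds (by linarith) (by linarith), by
      rw [Measure.smul_apply, smul_eq_mul]
      exact ENNReal.mul_lt_top ofReal_lt_top
        ((Measure.restrict_apply_le _ _).trans_lt (by simp))⟩⟩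
  refine (Measure.ext_of_Ico _ _ fun a b hab => ?_).symm
  rw [Measure.map_apply hm measurableSet_Ico, Measure.smul_apply, smul_eq_mul,
    Measure.restrict_congr_set Ioi_ae_eq_Ici, Measure.restrict_apply measurableSet_Ico]
  rcases le_or_gt b 0 with hb | hb
  · have h1 : Ico a b ∩ Ici (0 : ℝ) = ∅ := by
      ext x; simp only [mem_inter_iff, mem_Ico, mem_Ici, mem_empty_iff_false]
      constructor
      · rintro ⟨⟨_, h1⟩, h2⟩; linarith
      · exact False.elim
    have h2 : (fun x : Plane => ‖x‖ ^ 2) ⁻¹' Ico a b = ∅ := by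
      ext x; simp only [mem_preimage, mem_Ico, mem_empty_iff_false]
      constructor
      · rintro ⟨_, h1⟩; nlinarith [sq_nonneg ‖x‖]
      · exact False.elim
    simp [h1, h2]
  · have h1 : Ico a b ∩ Ici (0 : ℝ) = Ico (max a 0) b := by
      ext x; simp [and_comm, and_left_comm]
    have h2 : (fun x : Plane => ‖x‖ ^ 2) ⁻¹' Ico a b =
        Metric.ball 0 (√b) \ Metric.ball 0 (√(max a 0)) := by
      rw [← hpre hb.le, ← hpre (le_max_right a 0)]
      ext x
      have := sq_nonneg ‖x‖
      simp only [mem_preimage, mem_Ico, Set.mem_sdiff, mem_Iio, not_lt, max_le_iff]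
      tauto
    have h3 : max a 0 < b := max_lt hab hb
    rw [h1, h2, measure_sdiff (Metric.ball_subset_ball (Real.sqrt_le_sqrt h3.le))
      Metric.isOpen_ball.measurableSet.nullMeasurableSet Metric.isBounded_ball.measure_lt_top.ne,
      hball hb.le, hball (le_max_right a 0), Real.volume_Ico,
      ← ENNReal.ofReal_mul Real.pi_pos.le, mul_sub,
      ENNReal.ofReal_sub _ (mul_nonneg Real.pi_pos.le (le_max_right a 0))]

variable {Ω : Type*} [MeasurableSpace Ω] {μ : Measure Ω} {lam : ℝ} {X : ℕ → Ω → Plane}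

/-- The Laplace functional of a homogeneous Poisson process at a radial function. -/
theorem IsHomogeneousPPP.integral_negExp_tsum_radial [IsProbabilityMeasure μ]
    (h : IsHomogeneousPPP μ lam X) (hlam : 0 ≤ lam) {u : ℝ → ℝ≥0∞} (hu : Measurable u)
    (hint : IntegrableOn (fun v => 1 - negExp (u v)) (Ioi 0)) :
    ∫ ω, negExp (∑' i, u (‖X i ω‖ ^ 2)) ∂μ =
      Real.exp (-(Real.pi * lam * ∫ v in Ioi 0, (1 - negExp (u v)))) := by
  have hm : Measurable fun x : Plane => ‖x‖ ^ 2 := by fun_prop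
  have hg : Measurable fun v => ENNReal.ofReal (1 - negExp (u v)) :=
    (measurable_const.sub (measurable_negExp.comp hu)).ennreal_ofReal
  have h0 : ∀ v, 0 ≤ 1 - negExp (u v) := fun v => sub_nonneg.2 (negExp_le_one _)
  have hL := h.integral_negExp_tsum hlam (hu.comp hm)
  simp only [Function.comp_apply] at hL
  rw [hL]
  have : ∫⁻ x : Plane, ENNReal.ofReal (1 - negExp (u (‖x‖ ^ 2))) =
      ENNReal.ofReal (Real.pi * ∫ v in Ioi 0, (1 - negExp (u v))) := by
    rw [← lintegral_map hg hm, map_norm_sq_volume, lintegral_smul_measure,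
      ENNReal.ofReal_mul Real.pi_pos.le,
      ofReal_integral_eq_lintegral_ofReal hint (ae_of_all _ h0), smul_eq_mul]
  rw [this, ← ENNReal.ofReal_mul hlam, negExp_ofReal]
  · ring_nf
  · exact mul_nonneg hlam (mul_nonneg Real.pi_pos.le (integral_nonneg h0))

/-- The function that is `∞` below `a`, `c` on `[a, b)` and `ψ` from `b` on. -/
def threePiece (a b : ℝ) (c : ℝ≥0∞) (ψ : ℝ → ℝ≥0∞) (v : ℝ) : ℝ≥0∞ :=
  if v < a then ∞ else if v < b then c else ψ v

lemma measurable_threePiece (a b : ℝ) (c : ℝ≥0∞) {ψ : ℝ → ℝ≥0∞} (hψ : Measurable ψ) :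
    Measurable (threePiece a b c ψ) :=
  Measurable.ite measurableSet_Iio measurable_const
    (Measurable.ite measurableSet_Iio measurable_const hψ)

lemma hasIntegral_threePiece {a b : ℝ} (ha : 0 ≤ a) (hab : a ≤ b) (c : ℝ≥0∞) {ψ : ℝ → ℝ≥0∞}
    (hint : IntegrableOn (fun v => 1 - negExp (ψ v)) (Ioi b)) :
    IntegrableOn (fun v => 1 - negExp (threePiece a b c ψ v)) (Ioi 0) ∧
    ∫ v in Ioi 0, (1 - negExp (threePiece a b c ψ v)) =
      a + (b - a) * (1 - negExp c) + ∫ v in Ioi b, (1 - negExp (ψ v)) := by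
  set f := fun v => 1 - negExp (threePiece a b c ψ v)
  have e1 : EqOn (fun _ => (1 : ℝ)) f (Ico 0 a) := fun v hv => by
    simp [f, threePiece, hv.2]
  have e2 : EqOn (fun _ => 1 - negExp c) f (Ico a b) := fun v hv => by
    simp [f, threePiece, hv.2, hv.1.not_gt]
  have e3 : EqOn (fun v => 1 - negExp (ψ v)) f (Ici b) := fun v hv => by
    have hv' : b ≤ v := hv
    simp [f, threePiece, hv'.not_gt, (hab.trans hv').not_gt]
  have i1 : IntegrableOn f (Ico 0 a) :=
    (integrableOn_const (by simp)).congr_fun e1 measurableSet_Ico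
  have i2 : IntegrableOn f (Ico a b) :=
    (integrableOn_const (by simp)).congr_fun e2 measurableSet_Ico
  have i3 : IntegrableOn f (Ici b) :=
    ((integrableOn_Ici_iff_integrableOn_Ioi (by simp)).2 hint).congr_fun e3 measurableSet_Ici
  have hun : Ioi (0 : ℝ) =ᵐ[volume] ((Ico 0 a ∪ Ico a b) ∪ Ici b : Set ℝ) := by
    rw [Ico_union_Ico_eq_Ico ha hab, Ico_union_Ici_eq_Ici (ha.trans hab)]
    exact Ioi_ae_eq_Ici
  have i12 : IntegrableOn f (Ico 0 a ∪ Ico a b) := i1.union i2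
  refine ⟨(i12.union i3).congr_set_ae hun, ?_⟩
  rw [setIntegral_congr_set hun, setIntegral_union _ measurableSet_Ici i12 i3,
    setIntegral_union _ measurableSet_Ico i1 i2, ← setIntegral_congr_fun measurableSet_Ico e1,
    ← setIntegral_congr_fun measurableSet_Ico e2, ← setIntegral_congr_fun measurableSet_Ici e3,
    integral_Ici_eq_integral_Ioi]
  · simp [ha, hab, measureReal_def]
  · rw [Set.disjoint_left]; rintro x ⟨_, h1⟩ ⟨h2, _⟩; linarith
  · rw [Ico_union_Ico_eq_Ico ha hab, Set.disjoint_left]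
    rintro x ⟨_, h1⟩ h2
    have : b ≤ x := h2
    linarith

/-- The parameter `c` is the cost of a point in the strip `[a, b)`: with `c = ∞` only configurations
without points below `b` count, with `c = 0` only points below `a` are forbidden. -/
lemma IsHomogeneousPPP.integral_negExp_threePiece [IsProbabilityMeasure μ]
    (h : IsHomogeneousPPP μ lam X) (hlam : 0 ≤ lam) {a b : ℝ} (ha : 0 ≤ a) (hab : a ≤ b)
    (c : ℝ≥0∞) {ψ : ℝ → ℝ≥0∞} (hψ : Measurable ψ)
    (hint : IntegrableOn (fun v => 1 - negExp (ψ v)) (Ioi b)) :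
    ∫ ω, negExp (∑' i, threePiece a b c ψ (‖X i ω‖ ^ 2)) ∂μ =
      Real.exp (-(Real.pi * lam *
        (a + (b - a) * (1 - negExp c) + ∫ v in Ioi b, (1 - negExp (ψ v))))) := by
  obtain ⟨h1, h2⟩ := hasIntegral_threePiece ha hab c hint
  rw [h.integral_negExp_tsum_radial hlam (measurable_threePiece a b c hψ) h1, h2]

/-- Minus the logarithm of the Laplace transform of an interfering Rayleigh faded signal from
squared distance `v`, normalized by the signal from squared distance `b`. -/
def fadingExponent (t α b v : ℝ) : ℝ≥0∞ := ENNReal.ofReal (Real.log (1 + t * (b / v) ^ (α / 2)))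

@[fun_prop]
lemma measurable_fadingExponent (t α b : ℝ) : Measurable (fadingExponent t α b) := by
  unfold fadingExponent
  fun_prop

lemma negExp_log_one_add {w : ℝ} (hw : 0 ≤ w) :
    negExp (ENNReal.ofReal (Real.log (1 + w))) = (1 + w)⁻¹ := by
  rw [negExp_ofReal (Real.log_nonneg (by linarith)), Real.exp_neg, Real.exp_log (by linarith)]

lemma negExp_fadingExponent {t α b v : ℝ} (ht : 0 ≤ t) (hb : 0 ≤ b) (hv : 0 ≤ v) :
    negExp (fadingExponent t α b v) = (1 + t * (b / v) ^ (α / 2))⁻¹ :=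
  negExp_log_one_add (mul_nonneg ht (Real.rpow_nonneg (div_nonneg hb hv) _))

lemma fadingExponent_mono {t α a b v : ℝ} (ht : 0 ≤ t) (hα : 0 ≤ α) (ha : 0 ≤ a) (hab : a ≤ b)
    (hv : 0 ≤ v) : fadingExponent t α a v ≤ fadingExponent t α b v := by
  refine ENNReal.ofReal_le_ofReal (Real.log_le_log ?_ ?_)
  · have := mul_nonneg ht (Real.rpow_nonneg (div_nonneg ha hv) (α / 2))
    linarith
  · gcongr

lemma integrableOn_one_div_one_add_rpow {α c : ℝ} (hα : 2 < α) (hc : 0 < c) :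
    IntegrableOn (fun u : ℝ => 1 / (1 + u ^ (α / 2))) (Ioi c) := by
  refine Integrable.mono' (integrableOn_Ioi_rpow_of_lt (a := -(α / 2)) (by linarith) hc) ?_ ?_
  · exact (by fun_prop : Measurable fun u : ℝ => 1 / (1 + u ^ (α / 2))).aestronglyMeasurable
  · filter_upwards [ae_restrict_mem measurableSet_Ioi] with u hu
    have hu0 : 0 < u := hc.trans hu
    have hp : 0 < u ^ (α / 2) := Real.rpow_pos_of_pos hu0 _
    rw [Real.norm_of_nonneg (by positivity), Real.rpow_neg hu0.le, one_div]
    exact inv_anti₀ hp (by linarith)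

lemma rho_nonneg {t α : ℝ} (ht : 0 ≤ t) : 0 ≤ rho t α := by
  refine mul_nonneg (Real.rpow_nonneg ht _) (setIntegral_nonneg measurableSet_Ioi fun u hu => ?_)
  have : 0 ≤ u := (Real.rpow_nonneg ht _).trans (le_of_lt hu)
  positivity

/-- This is `1 - (1 + w)⁻¹ = (1 + w⁻¹)⁻¹` with `t` written as `(t^{2/α})^{α/2}` and absorbed into
the length scale. In the variable `v / (b t^{2/α})` it is the integrand of `rho`. -/
lemma one_sub_negExp_fadingExponent {t α b v : ℝ} (ht : 0 < t) (hα : 2 < α) (hb : 0 < b)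
    (hv : 0 < v) : 1 - negExp (fadingExponent t α b v) =
      1 / (1 + ((b * t ^ (2 / α))⁻¹ * v) ^ (α / 2)) := by
  rw [negExp_fadingExponent ht.le hb.le hv.le]
  have h1 : ((b * t ^ (2 / α))⁻¹ * v) ^ (α / 2) = (t * (b / v) ^ (α / 2))⁻¹ := by
    have : t = (t ^ (2 / α)) ^ (α / 2) := by
      rw [← Real.rpow_mul ht.le, div_mul_div_comm, mul_comm, div_self (by positivity),
        Real.rpow_one]
    conv_rhs => rw [this]
    rw [← Real.mul_rpow (by positivity) (by positivity), ← Real.inv_rpow (by positivity)]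
    congr 1
    field_simp
  have hp : 0 < t * (b / v) ^ (α / 2) := by positivity
  rw [h1]
  field_simp
  ring

lemma integrableOn_fadingExponent {t α b c : ℝ} (ht : 0 < t) (hα : 2 < α) (hb : 0 < b)
    (hc : 0 < c) : IntegrableOn (fun v => 1 - negExp (fadingExponent t α b v)) (Ioi c) := by
  have hs : 0 < (b * t ^ (2 / α))⁻¹ := by positivity
  refine ((integrableOn_Ioi_comp_mul_left_iff _ c hs).2
    (integrableOn_one_div_one_add_rpow hα (mul_pos hs hc))).congr_fun (fun v hv => ?_)
    measurableSet_Ioi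
  exact (one_sub_negExp_fadingExponent ht hα hb (hc.trans hv)).symm

lemma integral_fadingExponent {t α b : ℝ} (ht : 0 < t) (hα : 2 < α) (hb : 0 < b) :
    ∫ v in Ioi b, (1 - negExp (fadingExponent t α b v)) = b * rho t α := by
  have hs : 0 < (b * t ^ (2 / α))⁻¹ := by positivity
  rw [setIntegral_congr_fun measurableSet_Ioi fun v hv =>
    one_sub_negExp_fadingExponent ht hα hb (hb.trans hv),
    integral_comp_mul_left_Ioi (fun u => 1 / (1 + u ^ (α / 2))) b hs, rho]
  have : (b * t ^ (2 / α))⁻¹ * b = t ^ (-2 / α) := by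
    rw [neg_div, Real.rpow_neg ht.le]
    field_simp
  rw [this, inv_inv, smul_eq_mul, mul_assoc]

/-- Covers strips that start at the origin, where the rescaling by `b` is not available. -/
lemma fadingExponent_zero {t α v : ℝ} (hα : 0 < α) : fadingExponent t α 0 v = 0 := by
  simp [fadingExponent, Real.zero_rpow (show α / 2 ≠ 0 by positivity)]

lemma integrableOn_fadingExponent_of_le {t α a b : ℝ} (ht : 0 < t) (hα : 2 < α) (ha : 0 ≤ a)
    (hab : a < b) : IntegrableOn (fun v => 1 - negExp (fadingExponent t α a v)) (Ioi b) := by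
  rcases ha.eq_or_lt with rfl | ha
  · simp [fadingExponent_zero (show 0 < α by linarith)]
  · exact integrableOn_fadingExponent ht hα ha (ha.trans hab)

/-- The integral from `a` on is `a * rho t α`, and `(a, b]` carries at most `b - a` of it because
the integrand is at most one. The upper strip bound pays for this loss with the factor `exp (m (b -
a))`. -/
lemma le_integral_fadingExponent {t α a b : ℝ} (ht : 0 < t) (hα : 2 < α) (ha : 0 ≤ a)
    (hab : a < b) :
    a * rho t α - (b - a) ≤ ∫ v in Ioi b, (1 - negExp (fadingExponent t α a v)) := by
  rcases ha.eq_or_lt with rfl | ha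
  · simp [fadingExponent_zero (show 0 < α by linarith), hab.le]
  have hi := integrableOn_fadingExponent ht hα ha ha
  rw [← integral_fadingExponent ht hα ha, ← Ioc_union_Ioi_eq_Ioi hab.le,
    setIntegral_union Ioc_disjoint_Ioi_same measurableSet_Ioi (hi.mono_set Ioc_subset_Ioi_self)
      (hi.mono_set (Ioi_subset_Ioi hab.le))]
  have : ∫ v in Ioc a b, (1 - negExp (fadingExponent t α a v)) ≤ ∫ v in Ioc a b, (1 : ℝ) :=
    setIntegral_mono (hi.mono_set Ioc_subset_Ioi_self) (integrableOn_const (by simp)) fun v => by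
      have := negExp_nonneg (fadingExponent t α a v); simp only; linarith
  simp only [integral_const, MeasurableSet.univ, measureReal_restrict_apply, univ_inter,
    Real.volume_real_Ioc_of_le hab.le, smul_eq_mul, mul_one] at this
  linarith

end

/-! ### Nearest point and interference: strip bounds and integration over the distance -/

section

lemma nearestDist_nonneg (x : ℕ → Plane) : 0 ≤ nearestDist x :=
  Real.iInf_nonneg fun _ => norm_nonneg _

lemma bddBelow_range_norm (x : ℕ → Plane) : BddBelow (range fun i => ‖x i‖) :=
  ⟨0, by rintro _ ⟨i, rfl⟩; exact norm_nonneg _⟩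

lemma nearestDist_le (x : ℕ → Plane) (i : ℕ) : nearestDist x ≤ ‖x i‖ :=
  ciInf_le (bddBelow_range_norm x) i

lemma nearestDist_sq_le (x : ℕ → Plane) (i : ℕ) : nearestDist x ^ 2 ≤ ‖x i‖ ^ 2 :=
  pow_le_pow_left₀ (nearestDist_nonneg x) (nearestDist_le x i) 2

lemma nearestDist_sq_lt_iff (x : ℕ → Plane) {b : ℝ} :
    nearestDist x ^ 2 < b ↔ ∃ i, ‖x i‖ ^ 2 < b := by
  constructor
  · intro h
    have h1 : nearestDist x < √b := (Real.lt_sqrt (nearestDist_nonneg x)).2 h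
    obtain ⟨i, hi⟩ := exists_lt_of_ciInf_lt h1
    exact ⟨i, (Real.lt_sqrt (norm_nonneg _)).1 hi⟩
  · rintro ⟨i, hi⟩
    exact (nearestDist_sq_le x i).trans_lt hi

@[fun_prop]
lemma measurable_nearestDist : Measurable nearestDist :=
  Measurable.iInf fun i => (measurable_pi_apply i).norm

open Classical in
/-- Minus the logarithm of the conditional Laplace transform of the interference, at `t` times the
inverse of the mean power received from the nearest base station. -/
def interferenceExponent (t α : ℝ) (x : ℕ → Plane) : ℝ≥0∞ :=
  ∑' i, if ‖x i‖ = nearestDist x then 0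
    else fadingExponent t α (nearestDist x ^ 2) (‖x i‖ ^ 2)

@[fun_prop]
lemma measurable_interferenceExponent (t α : ℝ) : Measurable (interferenceExponent t α) := by
  refine Measurable.tsum fun i => Measurable.ite ?_ measurable_const ?_
  · exact measurableSet_eq_fun (measurable_pi_apply i).norm measurable_nearestDist
  · unfold fadingExponent
    fun_prop

section Deterministic

variable {t α a b : ℝ} (x : ℕ → Plane)

lemma negExp_tsum_eq_zero {f : ℕ → ℝ≥0∞} (i : ℕ) (hi : f i = ∞) : negExp (∑' j, f j) = 0 := by
  rw [ENNReal.tsum_eq_top_of_eq_top ⟨i, hi⟩, negExp_top]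

lemma negExp_tsum_mono {f g : ℕ → ℝ≥0∞} (h : ∀ i, f i ≤ g i) :
    negExp (∑' j, g j) ≤ negExp (∑' j, f j) :=
  negExp_antitone (ENNReal.tsum_le_tsum h)

/-- On the strip the subtracted term vanishes. The other one ignores the strip points and lowers the
nearest squared distance to `a` in the exponents of the farther points, so its exponent is too
small. Off the strip the difference is nonnegative because `0 ≤ ∞`. -/
lemma negExp_interferenceExponent_le (ht : 0 ≤ t) (hα : 0 ≤ α) (ha : 0 ≤ a) :
    (if a ≤ nearestDist x ^ 2 ∧ nearestDist x ^ 2 < b then negExp (interferenceExponent t α x)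
      else 0) ≤
    negExp (∑' i, threePiece a b 0 (fadingExponent t α a) (‖x i‖ ^ 2)) -
      negExp (∑' i, threePiece a b ∞ (fadingExponent t α a) (‖x i‖ ^ 2)) := by
  split_ifs with h
  · obtain ⟨i, hi⟩ := (nearestDist_sq_lt_iff x).1 h.2
    rw [negExp_tsum_eq_zero (f := fun i => threePiece a b ∞ (fadingExponent t α a) (‖x i‖ ^ 2)) i
      (by simp [threePiece, hi]), sub_zero]
    refine negExp_tsum_mono fun j => ?_
    have haj : a ≤ ‖x j‖ ^ 2 := h.1.trans (nearestDist_sq_le x j)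
    by_cases hj : ‖x j‖ ^ 2 < b
    · simp [threePiece, haj.not_gt, hj]
    · have hne : ‖x j‖ ≠ nearestDist x := fun he => hj (he ▸ h.2)
      simp only [threePiece, haj.not_gt, hj, hne, if_false]
      exact fadingExponent_mono ht hα ha h.1 (sq_nonneg _)
  · refine sub_nonneg.2 (negExp_tsum_mono fun j => ?_)
    unfold threePiece
    split_ifs <;> simp

/-- Each strip point is charged `log (1 + t)`, the largest exponent a point no closer than the
nearest can have. The nearest point is absent from the interference but is charged as well, which is
the factor `(1 + t)⁻¹`. -/
lemma le_negExp_interferenceExponent (ht : 0 ≤ t) (hα : 0 ≤ α) :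
    negExp (∑' i, threePiece a b (ENNReal.ofReal (Real.log (1 + t))) (fadingExponent t α b)
        (‖x i‖ ^ 2)) -
      negExp (∑' i, threePiece a b ∞ (fadingExponent t α b) (‖x i‖ ^ 2)) ≤
    (1 + t)⁻¹ * (if a ≤ nearestDist x ^ 2 ∧ nearestDist x ^ 2 < b then
      negExp (interferenceExponent t α x) else 0) := by
  set c := ENNReal.ofReal (Real.log (1 + t)) with hc
  set V := nearestDist x ^ 2
  have hV0 : 0 ≤ V := sq_nonneg _
  by_cases h1 : a ≤ V
  swap
  · obtain ⟨i, hi⟩ := (nearestDist_sq_lt_iff x).1 (not_le.1 h1)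
    rw [if_neg fun h => h1 h.1,
      negExp_tsum_eq_zero (f := fun i => threePiece a b c (fadingExponent t α b) (‖x i‖ ^ 2)) i
      (by simp [threePiece, hi]),
      negExp_tsum_eq_zero (f := fun i => threePiece a b ∞ (fadingExponent t α b) (‖x i‖ ^ 2)) i
      (by simp [threePiece, hi])]
    simp
  by_cases h2 : V < b
  swap
  · rw [if_neg fun h => h2 h.2, mul_zero]
    refine (sub_eq_zero.2 ?_).le
    congr 1
    refine tsum_congr fun i => ?_
    have : ¬ ‖x i‖ ^ 2 < b := fun hi => h2 ((nearestDist_sq_lt_iff x).2 ⟨i, hi⟩)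
    simp [threePiece, this]
  rw [if_pos ⟨h1, h2⟩]
  obtain ⟨i, hi⟩ := (nearestDist_sq_lt_iff x).1 h2
  rw [negExp_tsum_eq_zero (f := fun i => threePiece a b ∞ (fadingExponent t α b) (‖x i‖ ^ 2)) i
    (by simp [threePiece, hi]), sub_zero]
  have hav : ∀ i, a ≤ ‖x i‖ ^ 2 := fun i => h1.trans (nearestDist_sq_le x i)
  set f : ℕ → ℝ≥0∞ := fun i => threePiece a b c (fadingExponent t α b) (‖x i‖ ^ 2)
  have hlog : negExp c = (1 + t)⁻¹ := negExp_log_one_add ht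
  -- At `t = 0` the charge `c` is zero and infinitely many strip points would not make the sum
  -- diverge; there the exponent vanishes anyway.
  rcases ht.eq_or_lt with rfl | ht'
  · have : interferenceExponent 0 α x = 0 := by simp [interferenceExponent, fadingExponent]
    rw [this]
    simpa using negExp_le_one _
  have hc0 : c ≠ 0 := by
    rw [hc, ne_eq, ENNReal.ofReal_eq_zero, not_le]
    exact Real.log_pos (by linarith)
  by_cases hfin : {i | ‖x i‖ ^ 2 < b}.Finite
  swap
  · have : ∑' i, f i = ∞ := by
      by_contra hne
      refine hfin ((ENNReal.finite_const_le_of_tsum_ne_top hne hc0).subset fun i hi => ?_)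
      have hi' : ‖x i‖ ^ 2 < b := hi
      simp [f, threePiece, (hav i).not_gt, hi']
    rw [this, negExp_top]
    exact mul_nonneg (by positivity) (negExp_nonneg _)
  -- With finitely many points in the strip the infimum defining `nearestDist` is attained.
  obtain ⟨i₀, hi₀, hmin⟩ := hfin.exists_minimalFor (fun i => ‖x i‖) _ ⟨i, hi⟩
  have hi₀' : ‖x i₀‖ ^ 2 < b := hi₀
  have hnear : ‖x i₀‖ = nearestDist x := by
    refine le_antisymm (le_ciInf fun j => ?_) (nearestDist_le x i₀)
    by_contra! hj
    refine hj.not_ge (hmin ?_ hj.le)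
    exact (pow_lt_pow_left₀ hj (norm_nonneg _) two_ne_zero).trans hi₀'
  rw [← hlog, ← negExp_add]
  refine negExp_antitone ?_
  classical
  rw [interferenceExponent, ENNReal.tsum_eq_add_tsum_ite i₀ (f := f)]
  refine add_le_add (by simp [f, threePiece, (hav i₀).not_gt, hi₀']) ?_
  refine ENNReal.tsum_le_tsum fun j => ?_
  by_cases hj : ‖x j‖ = nearestDist x
  · simp [hj]
  have hj0 : j ≠ i₀ := fun h => hj (h ▸ hnear)
  simp only [hj, if_false, hj0, f, threePiece, (hav j).not_gt]
  -- In the strip `(V / |x j|²)^{α/2} ≤ 1`, so `c` dominates; beyond `b`, monotonicity in the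
  -- reference distance (`V < b`) does.
  split_ifs with hb
  · refine ENNReal.ofReal_le_ofReal (Real.log_le_log ?_ ?_)
    · have := mul_nonneg ht (Real.rpow_nonneg (div_nonneg hV0 (sq_nonneg ‖x j‖)) (α / 2))
      linarith
    · have := Real.rpow_le_one (div_nonneg hV0 (sq_nonneg ‖x j‖))
        (div_le_one_of_le₀ (nearestDist_sq_le x j) (sq_nonneg _)) (show 0 ≤ α / 2 by positivity)
      nlinarith
  · exact fadingExponent_mono ht hα hV0 h2.le (sq_nonneg _)

end Deterministic

/-- The integral of `Y` is determined by sharp bounds on its integrals over thin strips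
`a ≤ V < b`. -/
lemma integral_eq_of_strip_bounds {Ω : Type*} [MeasurableSpace Ω] {μ : Measure Ω} {V Y : Ω → ℝ}
    (hV : Measurable V) (hV0 : ∀ ω, 0 ≤ V ω) (hY : Integrable Y μ) {K : ℝ → ℝ} {m : ℝ} (hm : 0 ≤ m)
    (hK : Continuous K) (hK0 : ∀ v, 0 ≤ v → 0 ≤ K v) (hK1 : ∀ v, 0 ≤ v → K v ≤ 1)
    (hKi : IntegrableOn K (Ioi 0))
    (hlow : ∀ a b, 0 ≤ a → a < b → m * (b - a) * K b ≤ ∫ ω in {ω | a ≤ V ω ∧ V ω < b}, Y ω ∂μ)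
    (hupp : ∀ a b, 0 ≤ a → a < b → ∫ ω in {ω | a ≤ V ω ∧ V ω < b}, Y ω ∂μ ≤
      m * (b - a) * Real.exp (m * (b - a)) * K a) :
    ∫ ω, Y ω ∂μ = m * ∫ v in Ioi 0, K v := by
  -- `Φ` is the distribution function of `V` weighted by `Y`. The bounds on `[x, b)` as `b ↓ x` give
  -- only a right derivative, so the fundamental theorem also needs the continuity in `hcont`.
  set Φ : ℝ → ℝ := fun a => ∫ ω in {ω | V ω < a}, Y ω ∂μ with hΦ
  have hsm : ∀ a, MeasurableSet {ω | V ω < a} := fun a => measurableSet_lt hV measurable_const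
  have hstrip : ∀ a b, a < b → ∫ ω in {ω | a ≤ V ω ∧ V ω < b}, Y ω ∂μ = Φ b - Φ a := by
    intro a b hab
    have hu : {ω | V ω < b} = {ω | V ω < a} ∪ {ω | a ≤ V ω ∧ V ω < b} := by
      ext ω
      simp only [mem_ofPred_eq, mem_union]
      constructor
      · intro h
        rcases lt_or_ge (V ω) a with h1 | h1
        · exact Or.inl h1
        · exact Or.inr ⟨h1, h⟩
      · rintro (h | h)
        · exact h.trans hab
        · exact h.2
    have hd : Disjoint {ω | V ω < a} {ω | a ≤ V ω ∧ V ω < b} := by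
      rw [Set.disjoint_left]
      rintro ω h1 ⟨h2, _⟩
      exact (lt_irrefl _ (h2.trans_lt h1)).elim
    simp only [hΦ]
    rw [hu, setIntegral_union hd ((measurableSet_le measurable_const hV).inter (hsm b))
      hY.integrableOn hY.integrableOn]
    ring
  have hΦ0 : Φ 0 = 0 := by
    have : {ω | V ω < 0} = ∅ := by
      ext ω; simpa using hV0 ω
    simp [hΦ, this]
  have hder : ∀ x, 0 ≤ x → HasDerivWithinAt Φ (m * K x) (Ioi x) x := by
    intro x hx
    rw [hasDerivWithinAt_iff_tendsto_slope' self_notMem_Ioi]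
    have hl : Tendsto (fun b => m * K b) (𝓝[>] x) (𝓝 (m * K x)) :=
      ((hK.tendsto x).const_mul m).mono_left nhdsWithin_le_nhds
    have hr : Tendsto (fun b => m * Real.exp (m * (b - x)) * K x) (𝓝[>] x) (𝓝 (m * K x)) := by
      have : Continuous fun b => m * Real.exp (m * (b - x)) * K x := by fun_prop
      have h2 := (this.tendsto x).mono_left (nhdsWithin_le_nhds (s := Ioi x))
      simpa using h2
    refine tendsto_of_tendsto_of_tendsto_of_le_of_le' hl hr ?_ ?_
    · filter_upwards [self_mem_nhdsWithin] with b hb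
      have hb' : 0 < b - x := sub_pos.2 hb
      rw [slope_def_field, le_div_iff₀ hb', ← hstrip x b hb]
      linarith [hlow x b hx hb]
    · filter_upwards [self_mem_nhdsWithin] with b hb
      have hb' : 0 < b - x := sub_pos.2 hb
      rw [slope_def_field, div_le_iff₀ hb', ← hstrip x b hb]
      linarith [hupp x b hx hb]
  have hcont : ∀ T, ContinuousOn Φ (Icc 0 T) := by
    intro T
    have hC : 0 ≤ m * Real.exp (m * T) := by positivity
    refine (LipschitzOnWith.of_dist_le_mul (K := (m * Real.exp (m * T)).toNNReal) ?_).continuousOn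
    have key : ∀ a b, 0 ≤ a → a < b → b ≤ T → |Φ b - Φ a| ≤ m * Real.exp (m * T) * (b - a) := by
      intro a b ha hab hbT
      have h1 := hlow a b ha hab
      have h2 := hupp a b ha hab
      rw [hstrip a b hab] at h1 h2
      have hba : 0 < b - a := sub_pos.2 hab
      have h3 : 0 ≤ m * (b - a) * K b :=
        mul_nonneg (mul_nonneg hm hba.le) (hK0 b (ha.trans hab.le))
      rw [abs_of_nonneg (h3.trans h1)]
      refine h2.trans ?_
      calc m * (b - a) * Real.exp (m * (b - a)) * K a
          ≤ m * (b - a) * Real.exp (m * T) * 1 := by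
            have := hK1 a ha
            have := hK0 a ha
            gcongr
            linarith
        _ = m * Real.exp (m * T) * (b - a) := by ring
    intro a ha b hb
    rw [Real.dist_eq, Real.dist_eq, Real.coe_toNNReal _ hC]
    rcases lt_trichotomy a b with h | rfl | h
    · have := key a b ha.1 h hb.2
      rwa [abs_sub_comm, abs_sub_comm a, abs_of_pos (sub_pos.2 h)]
    · simp
    · have := key b a hb.1 h ha.2
      rwa [abs_of_pos (sub_pos.2 h)]
  have hFTC : ∀ n : ℕ, Φ n = m * ∫ v in (0 : ℝ)..n, K v := by
    intro n
    have := intervalIntegral.integral_eq_sub_of_hasDeriv_right_of_le (f' := fun v => m * K v)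
      (Nat.cast_nonneg n) (hcont n) (fun x hx => hder x hx.1.le)
      ((hK.const_mul m).intervalIntegrable _ _)
    rw [intervalIntegral.integral_const_mul, hΦ0, sub_zero] at this
    exact this.symm
  have hlim1 : Tendsto (fun n : ℕ => Φ n) atTop (𝓝 (m * ∫ v in Ioi 0, K v)) := by
    simp_rw [hFTC]
    exact (intervalIntegral_tendsto_integral_Ioi 0 hKi tendsto_natCast_atTop_atTop).const_mul m
  have hlim2 : Tendsto (fun n : ℕ => Φ n) atTop (𝓝 (∫ ω, Y ω ∂μ)) := by
    have := tendsto_setIntegral_of_monotone (μ := μ) (f := Y) (fun n : ℕ => hsm n)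
      (fun n k hnk ω (hω : V ω < n) => hω.trans_le (by exact_mod_cast hnk)) hY.integrableOn
    have hU : (⋃ n : ℕ, {ω | V ω < n}) = univ := by
      ext ω
      simpa using exists_nat_gt (V ω)
    rwa [hU, Measure.restrict_univ] at this
  exact tendsto_nhds_unique hlim2 hlim1

lemma integrableOn_mul_exp_neg {G : ℝ → ℝ} (hG : Continuous G) (hG0 : ∀ v, 0 ≤ v → 0 ≤ G v)
    (hG1 : ∀ v, 0 ≤ v → G v ≤ 1) {c : ℝ} (hc : 0 < c) :
    IntegrableOn (fun v => G v * Real.exp (-(c * v))) (Ioi 0) := by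
  refine Integrable.mono' (integrableOn_exp_mul_Ioi (neg_lt_zero.2 hc) 0)
    (by fun_prop : Continuous fun v => G v * Real.exp (-(c * v))).aestronglyMeasurable ?_
  filter_upwards [ae_restrict_mem measurableSet_Ioi] with v hv
  have hv0 : 0 ≤ v := le_of_lt hv
  rw [Real.norm_of_nonneg (mul_nonneg (hG0 v hv0) (Real.exp_pos _).le), neg_mul]
  exact mul_le_of_le_one_left (Real.exp_pos _).le (hG1 v hv0)

variable {Ω : Type*} [MeasurableSpace Ω] {μ : Measure Ω} {lam : ℝ} {X : ℕ → Ω → Plane}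

/-- The joint transform of the distance of the nearest base station and of the interference. -/
theorem IsHomogeneousPPP.integral_nearest [IsProbabilityMeasure μ]
    (h : IsHomogeneousPPP μ lam X) (hlam : 0 < lam) {t α : ℝ} (ht : 0 < t) (hα : 2 < α)
    {G : ℝ → ℝ} (hG : Continuous G) (hG0 : ∀ v, 0 ≤ v → 0 ≤ G v) (hG1 : ∀ v, 0 ≤ v → G v ≤ 1)
    (hGa : AntitoneOn G (Ici 0)) :
    ∫ ω, G (nearestDist (fun i => X i ω) ^ 2) *
        negExp (interferenceExponent t α fun i => X i ω) ∂μ =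
      Real.pi * lam *
        ∫ v in Ioi 0, G v * Real.exp (-(Real.pi * lam * v * (1 + rho t α))) := by
  set m := Real.pi * lam with hmdef
  have hm : 0 < m := mul_pos Real.pi_pos hlam
  have hρ := rho_nonneg (α := α) ht.le
  have hα0 : 0 < α := by linarith
  have hXm : Measurable fun ω i => X i ω := measurable_pi_lambda _ h.measurable
  have hVm : Measurable fun ω => nearestDist (fun i => X i ω) ^ 2 :=
    (measurable_nearestDist.comp hXm).pow_const 2
  have hSm : Measurable fun ω => interferenceExponent t α fun i => X i ω :=
    (measurable_interferenceExponent t α).comp hXm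
  have hSi : Integrable (fun ω => negExp (interferenceExponent t α fun i => X i ω)) μ :=
    integrable_negExp hSm
  have hYi : Integrable (fun ω => G (nearestDist (fun i => X i ω) ^ 2) *
      negExp (interferenceExponent t α fun i => X i ω)) μ := by
    refine Integrable.of_bound ((hG.measurable.comp hVm).mul
      (measurable_negExp.comp hSm)).aestronglyMeasurable 1 (ae_of_all _ fun ω => ?_)
    have h1 := hG0 _ (sq_nonneg (nearestDist fun i => X i ω))
    rw [Real.norm_of_nonneg (mul_nonneg h1 (negExp_nonneg _))]
    exact mul_le_one₀ (hG1 _ (sq_nonneg _)) (negExp_nonneg _) (negExp_le_one _)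
  have hint3 : ∀ (a b : ℝ) (c : ℝ≥0∞) (r : ℝ), Integrable (fun ω => negExp
      (∑' i, threePiece a b c (fadingExponent t α r) (‖X i ω‖ ^ 2))) μ := fun a b c r =>
    integrable_negExp (measurable_tsum_comp (X := X) (u := fun x =>
      threePiece a b c (fadingExponent t α r) (‖x‖ ^ 2)) h.measurable
      ((measurable_threePiece a b c (measurable_fadingExponent t α r)).comp (by fun_prop)))
  have hstrip : ∀ a b, MeasurableSet {ω | a ≤ nearestDist (fun i => X i ω) ^ 2 ∧
      nearestDist (fun i => X i ω) ^ 2 < b} := fun a b =>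
    (measurableSet_le measurable_const hVm).inter (measurableSet_lt hVm measurable_const)
  have hite : ∀ a b, (fun ω =>
      if a ≤ nearestDist (fun i => X i ω) ^ 2 ∧ nearestDist (fun i => X i ω) ^ 2 < b then
        negExp (interferenceExponent t α fun i => X i ω) else 0) =
      indicator {ω | a ≤ nearestDist (fun i => X i ω) ^ 2 ∧ nearestDist (fun i => X i ω) ^ 2 < b}
        fun ω => negExp (interferenceExponent t α fun i => X i ω) := fun a b => by
    ext ω
    simp [indicator_apply]
  have hind : ∀ a b, ∫ ω in {ω | a ≤ nearestDist (fun i => X i ω) ^ 2 ∧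
      nearestDist (fun i => X i ω) ^ 2 < b}, negExp (interferenceExponent t α fun i => X i ω) ∂μ =
      ∫ ω, (if a ≤ nearestDist (fun i => X i ω) ^ 2 ∧ nearestDist (fun i => X i ω) ^ 2 < b then
        negExp (interferenceExponent t α fun i => X i ω) else 0) ∂μ := fun a b => by
    rw [← integral_indicator (hstrip a b), hite]
  have hindi : ∀ a b, Integrable (fun ω =>
      if a ≤ nearestDist (fun i => X i ω) ^ 2 ∧ nearestDist (fun i => X i ω) ^ 2 < b then
        negExp (interferenceExponent t α fun i => X i ω) else 0) μ := fun a b => by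
    rw [hite]
    exact hSi.indicator (hstrip a b)
  set K : ℝ → ℝ := fun v => G v * Real.exp (-(m * v * (1 + rho t α))) with hKdef
  have hexp1 : ∀ v, 0 ≤ v → Real.exp (-(m * v * (1 + rho t α))) ≤ 1 := fun v hv => by
    rw [Real.exp_le_one_iff, neg_nonpos]; positivity
  refine integral_eq_of_strip_bounds (K := K) hVm (fun ω => sq_nonneg _) hYi hm.le (by fun_prop)
    (fun v hv => mul_nonneg (hG0 v hv) (Real.exp_pos _).le)
    (fun v hv => mul_le_one₀ (hG1 v hv) (Real.exp_pos _).le (hexp1 v hv)) ?_ ?_ ?_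
  · refine (integrableOn_mul_exp_neg hG hG0 hG1 (c := m * (1 + rho t α)) (by positivity)).congr_fun
      (fun v _ => ?_) measurableSet_Ioi
    simp only [hKdef]
    ring_nf
  · intro a b ha hab
    have hb : 0 < b := ha.trans_lt hab
    have h1 : G b * ∫ ω in {ω | a ≤ nearestDist (fun i => X i ω) ^ 2 ∧
        nearestDist (fun i => X i ω) ^ 2 < b}, negExp (interferenceExponent t α fun i => X i ω) ∂μ
        ≤ ∫ ω in {ω | a ≤ nearestDist (fun i => X i ω) ^ 2 ∧
        nearestDist (fun i => X i ω) ^ 2 < b}, G (nearestDist (fun i => X i ω) ^ 2) *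
        negExp (interferenceExponent t α fun i => X i ω) ∂μ := by
      rw [← integral_const_mul]
      refine setIntegral_mono_on (hSi.integrableOn.const_mul _) hYi.integrableOn (hstrip a b)
        fun ω hω => mul_le_mul_of_nonneg_right ?_ (negExp_nonneg _)
      exact hGa (mem_Ici.2 (sq_nonneg _)) hb.le hω.2.le
    refine le_trans ?_ h1
    have hif := integrableOn_fadingExponent ht hα hb hb
    have h2 := integral_mono ((hint3 a b (ENNReal.ofReal (Real.log (1 + t))) b).sub
      (hint3 a b ∞ b)) ((hindi a b).const_mul (1 + t)⁻¹) fun ω =>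
      le_negExp_interferenceExponent (fun i => X i ω) ht.le hα0.le
    simp only [Pi.sub_apply] at h2
    rw [integral_sub (hint3 _ _ _ _) (hint3 _ _ _ _), integral_const_mul,
      h.integral_negExp_threePiece hlam.le ha hab.le _ (measurable_fadingExponent t α b) hif,
      h.integral_negExp_threePiece hlam.le ha hab.le _ (measurable_fadingExponent t α b) hif,
      integral_fadingExponent ht hα hb, negExp_log_one_add ht.le, negExp_top, ← hind] at h2
    set q := (1 + t)⁻¹ with hq
    have hq0 : 0 < q := by positivity
    have e1 : -(Real.pi * lam * (a + (b - a) * (1 - q) + b * rho t α)) =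
        -(m * b * (1 + rho t α)) + q * (m * (b - a)) := by rw [← hmdef]; ring
    have e2 : -(Real.pi * lam * (a + (b - a) * (1 - 0) + b * rho t α)) =
        -(m * b * (1 + rho t α)) := by rw [← hmdef]; ring
    rw [e1, e2, Real.exp_add] at h2
    -- From `e^x - 1 ≥ x` the difference of the two functionals is at least `q m (b - a) e^{-m b (1
    -- + ρ)}`; the factor `q` then cancels against the `(1 + t)⁻¹` on the other side.
    have e3 := Real.add_one_le_exp (q * (m * (b - a)))
    have e4 := Real.exp_pos (-(m * b * (1 + rho t α)))
    have e5 : q * (m * (b - a) * Real.exp (-(m * b * (1 + rho t α)))) ≤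
        q * ∫ ω in {ω | a ≤ nearestDist (fun i => X i ω) ^ 2 ∧
        nearestDist (fun i => X i ω) ^ 2 < b},
          negExp (interferenceExponent t α fun i => X i ω) ∂μ := by
      refine le_trans ?_ h2
      nlinarith
    have e6 := mul_le_mul_of_nonneg_left (le_of_mul_le_mul_left e5 hq0) (hG0 b hb.le)
    simp only [hKdef]
    linarith
  · intro a b ha hab
    have hba : 0 < b - a := sub_pos.2 hab
    have h1 : ∫ ω in {ω | a ≤ nearestDist (fun i => X i ω) ^ 2 ∧
        nearestDist (fun i => X i ω) ^ 2 < b}, G (nearestDist (fun i => X i ω) ^ 2) *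
        negExp (interferenceExponent t α fun i => X i ω) ∂μ ≤
        G a * ∫ ω in {ω | a ≤ nearestDist (fun i => X i ω) ^ 2 ∧
        nearestDist (fun i => X i ω) ^ 2 < b},
          negExp (interferenceExponent t α fun i => X i ω) ∂μ := by
      rw [← integral_const_mul]
      refine setIntegral_mono_on hYi.integrableOn (hSi.integrableOn.const_mul _) (hstrip a b)
        fun ω hω => mul_le_mul_of_nonneg_right ?_ (negExp_nonneg _)
      exact hGa ha (mem_Ici.2 (sq_nonneg _)) hω.1
    refine h1.trans ?_
    have hif := integrableOn_fadingExponent_of_le ht hα ha hab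
    have h2 := integral_mono (hindi a b) ((hint3 a b 0 a).sub (hint3 a b ∞ a)) fun ω =>
      negExp_interferenceExponent_le (fun i => X i ω) ht.le hα0.le ha
    simp only [Pi.sub_apply] at h2
    rw [integral_sub (hint3 _ _ _ _) (hint3 _ _ _ _),
      h.integral_negExp_threePiece hlam.le ha hab.le _ (measurable_fadingExponent t α a) hif,
      h.integral_negExp_threePiece hlam.le ha hab.le _ (measurable_fadingExponent t α a) hif,
      negExp_zero, negExp_top, ← hind] at h2
    have h3 := le_integral_fadingExponent ht hα ha hab
    set J := ∫ v in Ioi b, (1 - negExp (fadingExponent t α a v))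
    have e1 : -(Real.pi * lam * (a + (b - a) * (1 - 0) + J)) =
        -(m * (a + J)) + -(m * (b - a)) := by rw [← hmdef]; ring
    have e2 : -(Real.pi * lam * (a + (b - a) * (1 - 1) + J)) = -(m * (a + J)) := by
      rw [← hmdef]; ring
    rw [e1, e2, Real.exp_add] at h2
    -- Here `1 - e^{-x} ≤ x` bounds the probability that the strip is occupied by its mean number of
    -- points.
    have e3 := Real.add_one_le_exp (-(m * (b - a)))
    have e4 := Real.exp_pos (-(m * (a + J)))
    have e5 : Real.exp (-(m * (a + J))) ≤
        Real.exp (m * (b - a)) * Real.exp (-(m * a * (1 + rho t α))) := by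
      rw [← Real.exp_add]
      refine Real.exp_le_exp.2 ?_
      nlinarith
    have e6 : ∫ ω in {ω | a ≤ nearestDist (fun i => X i ω) ^ 2 ∧
        nearestDist (fun i => X i ω) ^ 2 < b},
          negExp (interferenceExponent t α fun i => X i ω) ∂μ ≤
        m * (b - a) * (Real.exp (m * (b - a)) * Real.exp (-(m * a * (1 + rho t α)))) := by
      refine h2.trans (le_trans ?_ (mul_le_mul_of_nonneg_left e5 (by positivity)))
      nlinarith
    have e7 := mul_le_mul_of_nonneg_left e6 (hG0 a ha)
    simp only [hKdef]
    linarith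

end

/-! ### Rayleigh gains and their Laplace transforms -/

section

lemma integral_expMeasure_one (f : ℝ → ℝ) :
    ∫ y, f y ∂(expMeasure 1) = ∫ y in Ioi 0, Real.exp (-y) * f y := by
  have h1 : expMeasure 1 = volume.withDensity (exponentialPDF 1) := rfl
  have hm : Measurable (exponentialPDF 1) := (measurable_exponentialPDFReal 1).ennreal_ofReal
  rw [h1, integral_withDensity_eq_integral_toReal_smul hm (ae_of_all _ fun _ => ofReal_lt_top),
    ← integral_Ici_eq_integral_Ioi, ← integral_indicator measurableSet_Ici]
  congr 1
  ext y
  rw [exponentialPDF_eq]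
  by_cases hy : 0 ≤ y
  · rw [indicator_of_mem (mem_Ici.2 hy), if_pos hy,
      toReal_ofReal (mul_nonneg zero_le_one (Real.exp_pos _).le)]
    simp
  · rw [indicator_of_notMem (by simpa using hy), if_neg hy]
    simp

lemma expMeasure_one_Iic {s : ℝ} (hs : 0 ≤ s) :
    (expMeasure 1) (Iic s) = ENNReal.ofReal (1 - Real.exp (-s)) := by
  have h1 : expMeasure 1 = volume.withDensity (exponentialPDF 1) := rfl
  rw [h1, withDensity_apply _ measurableSet_Iic,
    lintegral_exponentialPDF_eq_antiDeriv one_pos, if_pos hs, one_mul]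

lemma integral_id_expMeasure_one : ∫ y, y ∂(expMeasure 1) = 1 := by
  rw [integral_expMeasure_one]
  have := Real.Gamma_eq_integral (s := 2) (by norm_num)
  rw [Real.Gamma_two] at this
  rw [this]
  refine setIntegral_congr_fun measurableSet_Ioi fun y _ => ?_
  norm_num

/-- Normalizing the SNR of a Rayleigh faded signal leaves its gain. -/
lemma normalizedSNR_eq {P α r : ℝ} (hP : 0 < P) (hr : 0 < r) (h : ℝ) :
    normalizedSNR P α r h = h := by
  have : ∫ y, rxPower P α r y ∂(expMeasure 1) = P * r ^ (-α) := by
    have h1 : ∀ y, rxPower P α r y = (P * r ^ (-α)) * y := fun y => by rw [rxPower]; ring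
    simp_rw [h1]
    rw [integral_const_mul, integral_id_expMeasure_one, mul_one]
  have hp : 0 < P * r ^ (-α) := mul_pos hP (Real.rpow_pos_of_pos hr _)
  rw [normalizedSNR, this, rxPower]
  field_simp

lemma integral_negExp_mul_expMeasure_one {w : ℝ} (hw : 0 ≤ w) :
    ∫ y, negExp (ENNReal.ofReal (y * w)) ∂(expMeasure 1) = (1 + w)⁻¹ := by
  rw [integral_expMeasure_one]
  have h1 : ∀ y ∈ Ioi (0 : ℝ), Real.exp (-y) * negExp (ENNReal.ofReal (y * w)) =
      Real.exp (-(1 + w) * y) := fun y hy => by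
    rw [negExp_ofReal (mul_nonneg (le_of_lt hy) hw), ← Real.exp_add]
    ring_nf
  rw [setIntegral_congr_fun measurableSet_Ioi h1, integral_exp_mul_Ioi (by linarith), mul_zero,
    Real.exp_zero, neg_div_neg_eq, one_div]

variable {Ω : Type*} [MeasurableSpace Ω] {μ : Measure Ω}

lemma IsRayleigh.ae_pos {g : ℕ → Ω → ℝ} (hg : IsRayleigh μ g) : ∀ᵐ ω ∂μ, ∀ i, 0 < g i ω := by
  refine ae_all_iff.2 fun i => ?_
  have h1 : (expMeasure 1) (Iic 0) = 0 := by rw [expMeasure_one_Iic le_rfl]; simp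
  rw [← hg.law i, Measure.map_apply (hg.measurable i) measurableSet_Iic] at h1
  filter_upwards [measure_eq_zero_iff_ae_notMem.1 h1] with ω hω
  simpa using hω

/-- The Laplace transform of a weighted sum of Rayleigh fading gains. -/
lemma IsRayleigh.integral_negExp_tsum [IsProbabilityMeasure μ] {g : ℕ → Ω → ℝ}
    (hg : IsRayleigh μ g) {w : ℕ → ℝ} (hw : ∀ i, 0 ≤ w i) :
    ∫ ω, negExp (∑' i, ENNReal.ofReal (g i ω * w i)) ∂μ =
      negExp (∑' i, ENNReal.ofReal (Real.log (1 + w i))) := by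
  have hfm : ∀ i, Measurable fun y : ℝ => negExp (ENNReal.ofReal (y * w i)) := fun i =>
    measurable_negExp.comp (by fun_prop)
  have hfin : ∀ n : ℕ, ∫ ω, negExp (∑ i ∈ Finset.range n, ENNReal.ofReal (g i ω * w i)) ∂μ =
      negExp (∑ i ∈ Finset.range n, ENNReal.ofReal (Real.log (1 + w i))) := fun n => by
    have hind : iIndepFun (fun (i : Fin n) => g i) μ := hg.indep.precomp Fin.val_injective
    have h1 := hind.integral_fun_prod_comp
      (f := fun (i : Fin n) y => negExp (ENNReal.ofReal (y * w i)))
      (fun i => (hg.measurable i).aemeasurable) (fun i => (hfm i).aestronglyMeasurable)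
    simp_rw [Finset.sum_range, negExp_sum]
    rw [h1]
    refine Finset.prod_congr rfl fun i _ => ?_
    rw [← integral_map (f := fun y => negExp (ENNReal.ofReal (y * w i)))
      (hg.measurable i).aemeasurable (hfm i).aestronglyMeasurable, hg.law,
      integral_negExp_mul_expMeasure_one (hw i), negExp_log_one_add (hw i)]
  have hL : Tendsto
      (fun n : ℕ => ∫ ω, negExp (∑ i ∈ Finset.range n, ENNReal.ofReal (g i ω * w i)) ∂μ) atTop
      (𝓝 (∫ ω, negExp (∑' i, ENNReal.ofReal (g i ω * w i)) ∂μ)) := by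
    refine tendsto_integral_negExp (fun n => ?_) (ae_of_all _ fun ω => ?_)
    · exact Finset.measurable_fun_sum _ fun i _ =>
        ((hg.measurable i).mul_const _).ennreal_ofReal
    · exact ENNReal.summable.hasSum.tendsto_sum_nat
  simp_rw [hfin] at hL
  exact tendsto_nhds_unique hL
    ((continuous_negExp.tendsto _).comp ENNReal.summable.hasSum.tendsto_sum_nat)

/-- Expectation of a bounded function of two independent variables, as an iterated expectation. -/
lemma integral_comp_prod_of_indepFun [IsProbabilityMeasure μ] {𝓐 𝓑 : Type*} [MeasurableSpace 𝓐]
    [MeasurableSpace 𝓑] {f : Ω → 𝓐} {g : Ω → 𝓑} (hf : Measurable f) (hg : Measurable g)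
    (hfg : IndepFun f g μ) {F : 𝓐 → 𝓑 → ℝ} (hF : Measurable fun p : 𝓐 × 𝓑 => F p.1 p.2)
    (hF1 : ∀ x y, |F x y| ≤ 1) :
    ∫ ω, F (f ω) (g ω) ∂μ = ∫ ω, ∫ ω', F (f ω') (g ω) ∂μ ∂μ := by
  have := Measure.isProbabilityMeasure_map (μ := μ) hf.aemeasurable
  have := Measure.isProbabilityMeasure_map (μ := μ) hg.aemeasurable
  have h1 : ∫ ω, F (f ω) (g ω) ∂μ = ∫ p, F p.1 p.2 ∂(μ.map fun ω => (f ω, g ω)) :=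
    (integral_map (hf.prodMk hg).aemeasurable hF.aestronglyMeasurable).symm
  rw [h1, (indepFun_iff_map_prod_eq_prod_map_map hf.aemeasurable hg.aemeasurable).1 hfg,
    integral_prod_symm _ (Integrable.of_bound hF.aestronglyMeasurable 1
      (ae_of_all _ fun p => hF1 _ _)), integral_map hg.aemeasurable]
  · congr 1
    ext ω
    exact integral_map hf.aemeasurable
      (hF.comp (measurable_id.prodMk measurable_const)).aestronglyMeasurable
  · exact hF.stronglyMeasurable.integral_prod_left'.aestronglyMeasurable

/-- The conditional Laplace transform of a shot noise with independent Rayleigh marks. -/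
lemma IsRayleigh.integral_mul_negExp_tsum [IsProbabilityMeasure μ] {g : ℕ → Ω → ℝ}
    (hg : IsRayleigh μ g) {X : ℕ → Ω → Plane} (hX : ∀ i, Measurable (X i))
    (hgX : IndepFun (fun ω i => g i ω) (fun ω i => X i ω) μ) {C : (ℕ → Plane) → ℝ}
    (hC : Measurable C) (hC1 : ∀ x, |C x| ≤ 1) {W : ℕ → (ℕ → Plane) → ℝ}
    (hW : ∀ i, Measurable (W i)) (hW0 : ∀ i x, 0 ≤ W i x) :
    ∫ ω, C (fun i => X i ω) * negExp (∑' i, ENNReal.ofReal (g i ω * W i fun i => X i ω)) ∂μ =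
      ∫ ω, C (fun i => X i ω) *
        negExp (∑' i, ENNReal.ofReal (Real.log (1 + W i fun i => X i ω))) ∂μ := by
  rw [integral_comp_prod_of_indepFun (measurable_pi_lambda _ hg.measurable)
    (measurable_pi_lambda _ hX) hgX
    (F := fun y x => C x * negExp (∑' i, ENNReal.ofReal (y i * W i x)))]
  · congr 1
    ext ω
    rw [integral_const_mul, hg.integral_negExp_tsum fun i => hW0 i _]
  · refine (hC.comp measurable_snd).mul (measurable_negExp.comp (Measurable.tsum fun i => ?_))
    exact (((measurable_pi_apply i).comp measurable_fst).mul
      ((hW i).comp measurable_snd)).ennreal_ofReal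
  · intro y x
    rw [abs_mul, abs_of_nonneg (negExp_nonneg _)]
    exact mul_le_one₀ (hC1 x) (negExp_nonneg _) (negExp_le_one _)

/-! ### Almost sure properties of the point process and its shot noise -/

variable {lam : ℝ} {X : ℕ → Ω → Plane}

lemma ae_of_forall_exp_le [IsProbabilityMeasure μ] {E : Set Ω} (hE : MeasurableSet E) {c : ℝ}
    (h : ∀ δ : ℝ, 0 < δ → Real.exp (-(c * δ)) ≤ μ.real E) : ∀ᵐ ω ∂μ, ω ∈ E := by
  have hlim : Tendsto (fun δ : ℝ => Real.exp (-(c * δ))) (𝓝[>] 0) (𝓝 1) := by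
    have : Continuous fun δ : ℝ => Real.exp (-(c * δ)) := by fun_prop
    simpa using (this.tendsto 0).mono_left (nhdsWithin_le_nhds (s := Ioi 0))
  have h1 : 1 ≤ μ.real E := le_of_tendsto hlim (by
    filter_upwards [self_mem_nhdsWithin] with δ hδ using h δ hδ)
  have h2 : μ E = 1 := by
    rw [← ENNReal.ofReal_toReal (measure_ne_top μ E), ← measureReal_def,
      le_antisymm measureReal_le_one h1, ofReal_one]
  exact (mem_ae_iff_prob_eq_one hE).2 h2

/-- With `ae_of_forall_exp_le` this turns Laplace transforms close to one into almost sure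
statements. -/
lemma integral_negExp_le_measureReal [IsProbabilityMeasure μ] {S : Ω → ℝ≥0∞} (hS : Measurable S)
    {E : Set Ω} (hE : MeasurableSet E) (h : ∀ ω, ω ∉ E → negExp (S ω) = 0) :
    ∫ ω, negExp (S ω) ∂μ ≤ μ.real E := by
  have h1 : ∫ ω, E.indicator (fun _ => (1 : ℝ)) ω ∂μ = μ.real E := by
    rw [integral_indicator hE]; simp
  rw [← h1]
  refine integral_mono (integrable_negExp hS) ((integrable_const _).indicator hE) fun ω => ?_
  by_cases hω : ω ∈ E
  · simpa [hω] using negExp_le_one _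
  · simp [hω, h ω hω]

/-- The disc of squared radius `δ` is empty with probability `exp (-π lam δ)`, which tends to one as
`δ → 0`. -/
lemma IsHomogeneousPPP.ae_nearestDist_pos [IsProbabilityMeasure μ]
    (h : IsHomogeneousPPP μ lam X) (hlam : 0 ≤ lam) :
    ∀ᵐ ω ∂μ, 0 < nearestDist fun i => X i ω := by
  have hXm : Measurable fun ω i => X i ω := measurable_pi_lambda _ h.measurable
  refine ae_of_forall_exp_le (E := {ω | 0 < nearestDist fun i => X i ω}) (c := Real.pi * lam)
    (measurableSet_lt measurable_const (measurable_nearestDist.comp hXm)) fun δ hδ => ?_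
  have h1 := h.integral_negExp_threePiece hlam le_rfl hδ.le ∞ (ψ := fun _ => 0)
    measurable_const (by simp)
  simp only [negExp_zero, negExp_top, sub_self, integral_zero, sub_zero, mul_one, zero_add,
    add_zero] at h1
  rw [← h1]
  refine integral_negExp_le_measureReal (measurable_tsum_comp (X := X) (u := fun x =>
      threePiece 0 δ ∞ (fun _ => 0) (‖x‖ ^ 2)) h.measurable
      ((measurable_threePiece 0 δ ∞ measurable_const).comp (by fun_prop)))
      (measurableSet_lt measurable_const (measurable_nearestDist.comp hXm)) fun ω hω => ?_
  have h0 : nearestDist (fun i => X i ω) = 0 :=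
    le_antisymm (not_lt.1 hω) (nearestDist_nonneg _)
  obtain ⟨i, hi⟩ := (nearestDist_sq_lt_iff fun i => X i ω).1
    (show nearestDist (fun i => X i ω) ^ 2 < δ by rw [h0]; simpa using hδ)
  exact negExp_tsum_eq_zero (f := fun i => threePiece 0 δ ∞ (fun _ => 0) (‖X i ω‖ ^ 2)) i
    (by simp [threePiece, hi])

/-- The complement of a ball has infinite area, hence void probability `e^{-∞} = 0`. This later
guarantees an interferer. -/
lemma IsHomogeneousPPP.ae_exists_le_norm [IsProbabilityMeasure μ]
    (h : IsHomogeneousPPP μ lam X) (hlam : 0 < lam) :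
    ∀ᵐ ω ∂μ, ∀ n : ℕ, ∃ i, (n : ℝ) ≤ ‖X i ω‖ := by
  refine ae_all_iff.2 fun n => ?_
  set u : Plane → ℝ≥0∞ := (Metric.ball 0 n)ᶜ.indicator fun _ => ∞
  have hB : MeasurableSet (Metric.ball (0 : Plane) n)ᶜ := Metric.isOpen_ball.measurableSet.compl
  have hu : Measurable u := measurable_const.indicator hB
  have h1 := h.integral_negExp_tsum hlam.le hu
  have h2 : ∫⁻ x, ENNReal.ofReal (1 - negExp (u x)) = ∞ := by
    have : ∀ x, ENNReal.ofReal (1 - negExp (u x)) =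
        (Metric.ball (0 : Plane) n)ᶜ.indicator (fun _ => 1) x := fun x => by
      by_cases hx : x ∈ (Metric.ball (0 : Plane) n)ᶜ
      · simp only [u, indicator_of_mem hx]; simp
      · simp only [u, indicator_of_notMem hx]; simp
    simp_rw [this]
    rw [lintegral_indicator_const hB, one_mul,
      measure_compl Metric.isOpen_ball.measurableSet Metric.isBounded_ball.measure_lt_top.ne,
      measure_univ_of_isAddLeftInvariant]
    exact ENNReal.top_sub Metric.isBounded_ball.measure_lt_top.ne
  rw [h2, ENNReal.mul_top (by simpa using hlam), negExp_top,
    integral_eq_zero_iff_of_nonneg (fun ω => negExp_nonneg _)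
      (integrable_negExp (measurable_tsum_comp h.measurable hu))] at h1
  filter_upwards [h1] with ω hω
  by_contra! hall
  have : ∑' i, u (X i ω) = 0 := ENNReal.tsum_eq_zero.2 fun i => by
    have := hall i
    simp [u, this]
  simp [this] at hω

/-- The shot noise of the whole process is almost surely finite. -/
lemma ae_tsum_ne_top [IsProbabilityMeasure μ] (h : IsHomogeneousPPP μ lam X) (hlam : 0 ≤ lam)
    {g : ℕ → Ω → ℝ} (hg : IsRayleigh μ g)
    (hgX : IndepFun (fun ω i => g i ω) (fun ω i => X i ω) μ) {α : ℝ} (hα : 2 < α) :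
    ∀ᵐ ω ∂μ, ∑' i, ENNReal.ofReal (g i ω * ‖X i ω‖ ^ (-α)) ≠ ∞ := by
  have hα0 : 0 < α := by linarith
  have hterm : ∀ i, Measurable fun ω => g i ω * ‖X i ω‖ ^ (-α) := fun i =>
    (hg.measurable i).mul ((h.measurable i).norm.pow_const _)
  have hSm : Measurable fun ω => ∑' i, ENNReal.ofReal (g i ω * ‖X i ω‖ ^ (-α)) :=
    Measurable.tsum fun i => (hterm i).ennreal_ofReal
  have hE : MeasurableSet {ω | ∑' i, ENNReal.ofReal (g i ω * ‖X i ω‖ ^ (-α)) ≠ ∞} :=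
    (hSm (measurableSet_singleton ∞)).compl
  refine ae_of_forall_exp_le hE
    (c := Real.pi * lam * ∫ u in Ioi (0 : ℝ), 1 / (1 + u ^ (α / 2))) fun δ hδ => ?_
  -- Chosen so that the length scale `ε^{2/α}` is `δ`: the Laplace transform of the shot noise at
  -- `ε` is then exactly `exp (-c δ)`.
  set ε := δ ^ (α / 2)
  have hε : 0 < ε := Real.rpow_pos_of_pos hδ _
  have hεδ : ε ^ (2 / α) = δ := by
    rw [← Real.rpow_mul hδ.le, div_mul_div_comm, mul_comm, div_self (by positivity),
        Real.rpow_one]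
  have hδ' : 0 < δ⁻¹ := inv_pos.2 hδ
  have h1 : ∀ v ∈ Ioi (0 : ℝ), 1 - negExp (fadingExponent ε α 1 v) =
      1 / (1 + (δ⁻¹ * v) ^ (α / 2)) := fun v hv => by
    rw [one_sub_negExp_fadingExponent hε hα one_pos hv, hεδ, one_mul]
  -- The integrand is bounded near zero, so the nearest point need not be removed for finiteness.
  have hi0 : IntegrableOn (fun u : ℝ => 1 / (1 + u ^ (α / 2))) (Ioi 0) := by
    rw [← Ioc_union_Ioi_eq_Ioi zero_le_one]
    refine IntegrableOn.union ?_ (integrableOn_one_div_one_add_rpow hα one_pos)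
    refine Measure.integrableOn_of_bounded (M := 1) (by simp)
      (by fun_prop : Measurable fun u : ℝ => 1 / (1 + u ^ (α / 2))).aestronglyMeasurable ?_
    filter_upwards [ae_restrict_mem measurableSet_Ioc] with u hu
    have : 0 ≤ u ^ (α / 2) := Real.rpow_nonneg hu.1.le _
    rw [Real.norm_of_nonneg (by positivity)]
    exact div_le_one_of_le₀ (by linarith) (by positivity)
  have hi1 : IntegrableOn (fun v => 1 - negExp (fadingExponent ε α 1 v)) (Ioi 0) := by
    refine IntegrableOn.congr_fun ?_ (fun v hv => (h1 v hv).symm) measurableSet_Ioi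
    have := (integrableOn_Ioi_comp_mul_left_iff (fun u : ℝ => 1 / (1 + u ^ (α / 2))) 0 hδ').2
    rw [mul_zero] at this
    exact this hi0
  have h2 := h.integral_negExp_tsum_radial hlam (measurable_fadingExponent ε α 1) hi1
  have h3 := integral_comp_mul_left_Ioi (fun u : ℝ => 1 / (1 + u ^ (α / 2))) 0 hδ'
  rw [mul_zero, inv_inv, smul_eq_mul] at h3
  rw [setIntegral_congr_fun measurableSet_Ioi h1, h3] at h2
  have hw : ∀ x : Plane, ε * (1 / ‖x‖ ^ 2) ^ (α / 2) = ε * ‖x‖ ^ (-α) := fun x => by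
    rw [one_div, Real.inv_rpow (sq_nonneg _), ← Real.rpow_natCast, ← Real.rpow_mul (norm_nonneg _),
      ← Real.rpow_neg (norm_nonneg _)]
    congr 2
    push_cast
    ring
  have h4 := hg.integral_mul_negExp_tsum h.measurable hgX (C := fun _ => 1) measurable_const
    (by simp) (W := fun i x => ε * ‖x i‖ ^ (-α))
    (fun i => ((measurable_pi_apply i).norm.pow_const _).const_mul _)
    (fun i x => by positivity)
  simp only [one_mul] at h4
  simp only [fadingExponent, hw] at h2
  rw [h2] at h4
  have h5 : Real.pi * lam * (δ * ∫ u in Ioi (0 : ℝ), 1 / (1 + u ^ (α / 2))) =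
    Real.pi * lam * (∫ u in Ioi (0 : ℝ), 1 / (1 + u ^ (α / 2))) * δ := by ring
  rw [h5] at h4
  rw [← h4]
  refine integral_negExp_le_measureReal (Measurable.tsum fun i => Measurable.ennreal_ofReal
    ((hg.measurable i).mul (((h.measurable i).norm.pow_const _).const_mul _))) hE fun ω hω => ?_
  have hω' : ∑' i, ENNReal.ofReal (g i ω * ‖X i ω‖ ^ (-α)) = ∞ := not_not.1 hω
  have : ∀ i, ENNReal.ofReal (g i ω * (ε * ‖X i ω‖ ^ (-α))) =
      ENNReal.ofReal ε * ENNReal.ofReal (g i ω * ‖X i ω‖ ^ (-α)) := fun i => by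
    rw [← ENNReal.ofReal_mul hε.le]
    ring_nf
  change negExp (∑' i, ENNReal.ofReal (g i ω * (ε * ‖X i ω‖ ^ (-α)))) = 0
  rw [tsum_congr this, ENNReal.tsum_mul_left, hω', ENNReal.mul_top (by simpa using hε), negExp_top]

end

/-! ### Gain of the scheduled user and coverage for a fixed number of users -/

section

/-- The largest of the gains of the users `0, …, n`. -/
def maxGain (n : ℕ) (h : ℕ → ℝ) : ℝ :=
  (Finset.range (n + 1)).sup' Finset.nonempty_range_add_one h

@[fun_prop]
lemma measurable_maxGain (n : ℕ) : Measurable (maxGain n) :=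
  Finset.measurable_range_sup'' fun k _ => measurable_pi_apply k

lemma maxGain_le_iff {n : ℕ} {h : ℕ → ℝ} {s : ℝ} :
    maxGain n h ≤ s ↔ ∀ i ∈ Finset.range (n + 1), h i ≤ s :=
  Finset.sup'_le_iff _ _

/-- Normalized SNRs are the gains themselves, so neither the distances nor the choice among ties
matters. -/
lemma gain_scheduledUser {P α : ℝ} (hP : 0 < P) {n : ℕ} {r h : ℕ → ℝ} (hr : ∀ i, 0 < r i) :
    h (scheduledUser P α n r h) = maxGain n h := by
  obtain ⟨h1, h2⟩ := (Finset.exists_max_image (Finset.range (n + 1))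
    (fun i => normalizedSNR P α (r i) (h i)) ⟨0, by simp⟩).choose_spec
  refine le_antisymm (Finset.le_sup' h h1) (maxGain_le_iff.2 fun i hi => ?_)
  have h3 : normalizedSNR P α (r i) (h i) ≤ normalizedSNR P α (r (scheduledUser P α n r h))
    (h (scheduledUser P α n r h)) := h2 i hi
  rwa [normalizedSNR_eq hP (hr i), normalizedSNR_eq hP (hr _)] at h3

variable {Ω : Type*} [MeasurableSpace Ω] {μ : Measure Ω}

lemma IsRayleigh.measureReal_lt_maxGain [IsProbabilityMeasure μ] {h : ℕ → Ω → ℝ}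
    (hh : IsRayleigh μ h) (n : ℕ) {s : ℝ} (hs : 0 ≤ s) :
    μ.real {ω | s < maxGain n fun i => h i ω} = 1 - (1 - Real.exp (-s)) ^ (n + 1) := by
  have hset : {ω | s < maxGain n fun i => h i ω} =
      (⋂ i ∈ Finset.range (n + 1), h i ⁻¹' Iic s)ᶜ := by
    ext ω
    simp only [mem_ofPred_eq, mem_compl_iff, mem_iInter, mem_preimage, mem_Iic]
    rw [← not_le, maxGain_le_iff]
  have hq : 0 ≤ 1 - Real.exp (-s) := by
    rw [sub_nonneg, Real.exp_le_one_iff]; linarith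
  have hm : ∀ i, μ (h i ⁻¹' Iic s) = ENNReal.ofReal (1 - Real.exp (-s)) := fun i => by
    rw [← Measure.map_apply (hh.measurable i) measurableSet_Iic, hh.law, expMeasure_one_Iic hs]
  rw [hset, probReal_compl_eq_one_sub (Finset.measurableSet_biInter _ fun i _ =>
      hh.measurable i measurableSet_Iic), measureReal_def,
    hh.indep.measure_inter_preimage_eq_mul _ fun i _ => measurableSet_Iic]
  simp [hm, toReal_ofReal hq]

lemma one_sub_one_sub_pow (x : ℝ) (m : ℕ) : 1 - (1 - x) ^ m =
    ∑ k ∈ Finset.Icc 1 m, (m.choose k : ℝ) * (-1) ^ (k + 1) * x ^ k := by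
  have h1 : (1 - x) ^ m = ∑ k ∈ Finset.range (m + 1), (m.choose k : ℝ) * (-1) ^ k * x ^ k := by
    rw [sub_eq_neg_add, add_pow]
    refine Finset.sum_congr rfl fun k _ => ?_
    rw [neg_pow]; ring
  rw [h1, Finset.range_eq_Ico, Finset.sum_eq_sum_Ico_succ_bot (Nat.succ_pos m)]
  simp only [Nat.choose_zero_right, Nat.cast_one, pow_zero, mul_one, zero_add, sub_add_cancel_left]
  rw [← Finset.sum_neg_distrib]
  exact Finset.sum_congr rfl fun k _ => by rw [pow_succ]; ring

open Classical in
/-- The interference, without the transmit power, as a sum in `[0, ∞]`. -/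
def shotNoise (α : ℝ) (z : (ℕ → Plane) × (ℕ → ℝ)) : ℝ≥0∞ :=
  ∑' i, if ‖z.1 i‖ = nearestDist z.1 then 0 else ENNReal.ofReal (z.2 i * ‖z.1 i‖ ^ (-α))

@[fun_prop]
lemma measurable_shotNoise (α : ℝ) : Measurable (shotNoise α) := by
  refine Measurable.tsum fun i => Measurable.ite ?_ measurable_const ?_
  · exact measurableSet_eq_fun ((measurable_pi_apply i).comp measurable_fst).norm
      (measurable_nearestDist.comp measurable_fst)
  · exact (((measurable_pi_apply i).comp measurable_snd).mul
      (((measurable_pi_apply i).comp measurable_fst).norm.pow_const _)).ennreal_ofReal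

lemma interference_eq {P α : ℝ} {x : ℕ → Plane} {g : ℕ → ℝ} (hg : ∀ i, 0 ≤ g i) :
    interference P α x g = P * (shotNoise α (x, g)).toReal := by
  rw [interference, shotNoise, ENNReal.tsum_toReal_eq fun i => by split_ifs <;> simp]
  congr 1
  refine tsum_congr fun i => ?_
  have : 0 ≤ g i * ‖x i‖ ^ (-α) := mul_nonneg (hg i) (by positivity)
  split_ifs
  · simp
  · rw [toReal_ofReal this]

/-- The fading gain at which the SINR of the tagged user equals the threshold `θ`. -/
def requiredGain (P α σ θ : ℝ) (z : (ℕ → Plane) × (ℕ → ℝ)) : ℝ :=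
  θ * (σ ^ 2 + P * (shotNoise α z).toReal) * nearestDist z.1 ^ α / P

lemma measurable_requiredGain (P α σ θ : ℝ) : Measurable (requiredGain P α σ θ) := by
  unfold requiredGain
  have h1 : Measurable fun z : (ℕ → Plane) × (ℕ → ℝ) => nearestDist z.1 :=
    measurable_nearestDist.comp measurable_fst
  have h2 : Measurable fun z => (shotNoise α z).toReal := (measurable_shotNoise α).ennreal_toReal
  exact ((((h2.const_mul P).const_add _).const_mul θ).mul (h1.pow_const α)).div_const P

lemma requiredGain_nonneg {P α σ θ : ℝ} (hP : 0 < P) (hθ : 0 < θ)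
    (z : (ℕ → Plane) × (ℕ → ℝ)) : 0 ≤ requiredGain P α σ θ z := by
  have := nearestDist_nonneg z.1
  unfold requiredGain
  positivity

/-- Positive interference keeps the denominator of the SINR positive even for `σ = 0`. -/
lemma SINR_gt_iff {P α σ θ : ℝ} (hP : 0 < P) {x : ℕ → Plane} {g r h : ℕ → ℝ}
    {n : ℕ} (hg : ∀ i, 0 ≤ g i) (hr : ∀ i, 0 < r i) (hR : 0 < nearestDist x)
    (hI : 0 < (shotNoise α (x, g)).toReal) :
    SINR P α σ x g n r h > θ ↔ requiredGain P α σ θ (x, g) < maxGain n h := by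
  have hpos : 0 < σ ^ 2 + P * (shotNoise α (x, g)).toReal := by positivity
  have hRα : 0 < nearestDist x ^ α := Real.rpow_pos_of_pos hR α
  rw [SINR, rxPower, gain_scheduledUser (h := h) hP hr, interference_eq hg, gt_iff_lt,
    lt_div_iff₀ hpos, requiredGain, div_lt_iff₀ hP, Real.rpow_neg hR.le, ← div_eq_mul_inv,
    lt_div_iff₀ hRα, mul_comm P (maxGain n h)]

/-- The noise factor of the integrand of the coverage probability. -/
def noiseFactor (P α σ θ : ℝ) (k : ℕ) (v : ℝ) : ℝ :=
  Real.exp (-(k * v ^ (α / 2) * θ * σ ^ 2 / P))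

lemma covIntegrand_eq (lamb P α σ θ : ℝ) (k : ℕ) (v : ℝ) : covIntegrand lamb P α σ θ k v =
    noiseFactor P α σ θ k v * Real.exp (-(Real.pi * lamb * v * (1 + rho (k * θ) α))) := by
  rw [covIntegrand, noiseFactor, ← Real.exp_add]
  ring_nf

section NoiseFactor

variable {P α σ θ : ℝ}

lemma continuous_noiseFactor (hα : 2 < α) (k : ℕ) : Continuous (noiseFactor P α σ θ k) := by
  have := Real.continuous_rpow_const (q := α / 2) (by linarith)
  unfold noiseFactor
  fun_prop

lemma noiseFactor_le_one (hP : 0 < P) (hθ : 0 < θ) (k : ℕ) {v : ℝ} (hv : 0 ≤ v) :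
    noiseFactor P α σ θ k v ≤ 1 := by
  rw [noiseFactor, Real.exp_le_one_iff, neg_nonpos]
  positivity

lemma antitoneOn_noiseFactor (hP : 0 < P) (hα : 2 < α) (hθ : 0 < θ) (k : ℕ) :
    AntitoneOn (noiseFactor P α σ θ k) (Ici 0) := by
  intro v hv w _ hvw
  have hv0 : 0 ≤ v := hv
  refine Real.exp_le_exp.2 (neg_le_neg ?_)
  gcongr

lemma integrableOn_covIntegrand (hP : 0 < P) (hα : 2 < α) (hθ : 0 < θ) (k : ℕ) {lamb : ℝ}
    (hlamb : 0 < lamb) :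
    IntegrableOn (covIntegrand lamb P α σ θ k) (Ioi 0) := by
  have hρ : 0 ≤ rho (k * θ) α := rho_nonneg (by positivity)
  have hc : 0 < Real.pi * lamb * (1 + rho (k * θ) α) := by positivity
  refine (integrableOn_mul_exp_neg (continuous_noiseFactor (P := P) (σ := σ) (θ := θ) hα k)
    (fun v _ => (Real.exp_pos _).le) (fun v hv => noiseFactor_le_one hP hθ k hv) hc).congr_fun
    (fun v _ => ?_) measurableSet_Ioi
  rw [covIntegrand_eq]
  ring_nf

end NoiseFactor

open Classical in
/-- The Laplace transform of the required gain. -/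
lemma integral_exp_requiredGain [IsProbabilityMeasure μ] {lamb P α σ θ : ℝ} (hlamb : 0 < lamb)
    (hP : 0 < P) (hα : 2 < α) (hθ : 0 < θ) {X : ℕ → Ω → Plane} {g : ℕ → Ω → ℝ}
    (hX : IsHomogeneousPPP μ lamb X) (hg : IsRayleigh μ g)
    (hgX : IndepFun (fun ω i => g i ω) (fun ω i => X i ω) μ)
    (hfin : ∀ᵐ ω ∂μ, shotNoise α (fun i => X i ω, fun i => g i ω) ≠ ∞) {k : ℕ} (hk : 1 ≤ k) :
    ∫ ω, Real.exp (-requiredGain P α σ θ (fun i => X i ω, fun i => g i ω)) ^ k ∂μ =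
      Real.pi * lamb * ∫ v in Ioi 0, covIntegrand lamb P α σ θ k v := by
  set t : ℝ := k * θ with ht
  have hk0 : (0 : ℝ) < k := by exact_mod_cast hk
  have ht0 : 0 < t := mul_pos hk0 hθ
  set W : ℕ → (ℕ → Plane) → ℝ := fun i x =>
    if ‖x i‖ = nearestDist x then 0 else t * (nearestDist x ^ 2 / ‖x i‖ ^ 2) ^ (α / 2) with hWdef
  have hWm : ∀ i, Measurable (W i) := fun i => by
    refine Measurable.ite ?_ measurable_const (by fun_prop)
    exact measurableSet_eq_fun (measurable_pi_apply i).norm measurable_nearestDist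
  have hW0 : ∀ i x, 0 ≤ W i x := fun i x => by
    simp only [hWdef]
    split_ifs <;> positivity
  have hpow : ∀ r : ℝ, 0 ≤ r → (r ^ 2) ^ (α / 2) = r ^ α := fun r hr => by
    rw [← Real.rpow_natCast, ← Real.rpow_mul hr]
    congr 1
    push_cast
    ring
  have hWeq : ∀ i (x : ℕ → Plane), ‖x i‖ ≠ nearestDist x →
      W i x = t * nearestDist x ^ α * ‖x i‖ ^ (-α) := fun i x hne => by
    simp only [hWdef, if_neg hne]
    rw [Real.div_rpow (sq_nonneg _) (sq_nonneg _), hpow _ (nearestDist_nonneg x),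
      hpow _ (norm_nonneg _), Real.rpow_neg (norm_nonneg _)]
    ring
  have hG0 : ∀ v, 0 ≤ noiseFactor P α σ θ k v := fun v => (Real.exp_pos _).le
  have h1 : ∀ᵐ ω ∂μ, Real.exp (-requiredGain P α σ θ (fun i => X i ω, fun i => g i ω)) ^ k =
      noiseFactor P α σ θ k (nearestDist (fun i => X i ω) ^ 2) *
        negExp (∑' i, ENNReal.ofReal (g i ω * W i fun i => X i ω)) := by
    -- Finiteness matters: `requiredGain` uses `toReal`, which would send an infinite shot noise to
    -- `0`, whereas `negExp` treats it as infinite.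
    filter_upwards [hfin] with ω hω
    set x : ℕ → Plane := fun i => X i ω
    have hR := nearestDist_nonneg x
    have htR : 0 ≤ t * nearestDist x ^ α := by positivity
    have h2 : ∑' i, ENNReal.ofReal (g i ω * W i x) =
        ENNReal.ofReal (t * nearestDist x ^ α) * shotNoise α (x, fun i => g i ω) := by
      rw [shotNoise, ← ENNReal.tsum_mul_left]
      refine tsum_congr fun i => ?_
      by_cases hi : ‖x i‖ = nearestDist x
      · simp [hWdef, hi]
      · simp only [hi, if_false]
        rw [hWeq i x hi, ← ENNReal.ofReal_mul htR]
        ring_nf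
    rw [h2, negExp_coe (ENNReal.mul_ne_top ofReal_ne_top hω), toReal_mul, toReal_ofReal htR,
      noiseFactor, hpow _ hR, ← Real.exp_nat_mul, ← Real.exp_add, requiredGain, ht]
    congr 1
    field_simp
    ring
  rw [integral_congr_ae h1]
  have h3 := hg.integral_mul_negExp_tsum hX.measurable hgX
    (C := fun x => noiseFactor P α σ θ k (nearestDist x ^ 2))
    ((continuous_noiseFactor hα k).measurable.comp (measurable_nearestDist.pow_const 2))
    (fun x => by
      rw [abs_of_nonneg (hG0 _)]
      exact noiseFactor_le_one hP hθ k (sq_nonneg _)) hWm hW0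
  rw [h3]
  have h4 : ∀ x : ℕ → Plane, ∑' i, ENNReal.ofReal (Real.log (1 + W i x)) =
      interferenceExponent t α x := fun x => by
    rw [interferenceExponent]
    refine tsum_congr fun i => ?_
    by_cases hi : ‖x i‖ = nearestDist x
    · simp [hWdef, hi]
    · simp only [hWdef, hi, if_false, fadingExponent]
  simp_rw [h4]
  rw [hX.integral_nearest hlamb ht0 hα (continuous_noiseFactor hα k) (fun v _ => hG0 v)
    (fun v hv => noiseFactor_le_one hP hθ k hv) (antitoneOn_noiseFactor hP hα hθ k)]
  simp_rw [covIntegrand_eq, ht]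

lemma shotNoise_ne_top {α : ℝ} {x : ℕ → Plane} {g : ℕ → ℝ}
    (h : ∑' i, ENNReal.ofReal (g i * ‖x i‖ ^ (-α)) ≠ ∞) : shotNoise α (x, g) ≠ ∞ := by
  refine ne_top_of_le_ne_top h (ENNReal.tsum_le_tsum fun i => ?_)
  simp only
  split_ifs <;> simp

lemma shotNoise_ne_zero {α : ℝ} {x : ℕ → Plane} {g : ℕ → ℝ} (hg : ∀ i, 0 < g i)
    (hx : ∀ n : ℕ, ∃ i, (n : ℝ) ≤ ‖x i‖) : shotNoise α (x, g) ≠ 0 := by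
  obtain ⟨n, hn⟩ := exists_nat_gt (nearestDist x)
  obtain ⟨i, hi⟩ := hx n
  have hlt : nearestDist x < ‖x i‖ := hn.trans_le hi
  have h0 : 0 < ‖x i‖ := (nearestDist_nonneg x).trans_lt hlt
  intro h
  have := ENNReal.tsum_eq_zero.1 h i
  simp only [hlt.ne', if_false, ENNReal.ofReal_eq_zero] at this
  exact this.not_gt (mul_pos (hg i) (Real.rpow_pos_of_pos h0 _))

/-- The coverage probability given the number of other users. -/
lemma measureReal_requiredGain_lt_maxGain [IsProbabilityMeasure μ] {lamb P α σ θ : ℝ}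
    (hlamb : 0 < lamb) (hP : 0 < P) (hα : 2 < α) (hθ : 0 < θ) {X : ℕ → Ω → Plane}
    {g h : ℕ → Ω → ℝ} (hX : IsHomogeneousPPP μ lamb X) (hg : IsRayleigh μ g) (hh : IsRayleigh μ h)
    (hgX : IndepFun (fun ω i => g i ω) (fun ω i => X i ω) μ)
    (hhXg : IndepFun (fun ω i => h i ω) (fun ω => (fun i => X i ω, fun i => g i ω)) μ)
    (hfin : ∀ᵐ ω ∂μ, shotNoise α (fun i => X i ω, fun i => g i ω) ≠ ∞) (n : ℕ) :
    μ.real {ω | requiredGain P α σ θ (fun i => X i ω, fun i => g i ω) <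
        maxGain n fun i => h i ω} =
      Real.pi * lamb * ∑ k ∈ Finset.Icc 1 (n + 1), ((n + 1).choose k : ℝ) * (-1) ^ (k + 1) *
        ∫ v in Ioi (0 : ℝ), covIntegrand lamb P α σ θ k v := by
  have hXm : Measurable fun ω i => X i ω := measurable_pi_lambda _ hX.measurable
  have hgm : Measurable fun ω i => g i ω := measurable_pi_lambda _ hg.measurable
  have hhm : Measurable fun ω i => h i ω := measurable_pi_lambda _ hh.measurable
  have hs := measurable_requiredGain P α σ θ
  set D : Set ((ℕ → ℝ) × ((ℕ → Plane) × (ℕ → ℝ))) :=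
    {p | requiredGain P α σ θ p.2 < maxGain n p.1} with hDdef
  have hD : MeasurableSet D := measurableSet_lt (hs.comp measurable_snd)
    ((measurable_maxGain n).comp measurable_fst)
  -- The threshold is frozen by fixing `(X, g)`, and the gains `h` are averaged first.
  have h1 := integral_comp_prod_of_indepFun hhm (hXm.prodMk hgm) hhXg
    (F := fun y z => D.indicator (fun _ => (1 : ℝ)) (y, z)) (measurable_const.indicator hD)
    (fun y z => by
      by_cases hyz : (y, z) ∈ D <;> simp [hyz])
  have hind : ∀ {E : Set Ω}, MeasurableSet E →
      ∫ ω, E.indicator (fun _ => (1 : ℝ)) ω ∂μ = μ.real E := fun hE => by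
    rw [integral_indicator hE]; simp
  have hL : ∫ ω, D.indicator (fun _ => (1 : ℝ))
      (fun i => h i ω, (fun i => X i ω, fun i => g i ω)) ∂μ = μ.real {ω | requiredGain P α σ θ (fun i => X i ω, fun i => g i ω) <
        maxGain n fun i => h i ω} := by
    have hm : MeasurableSet {ω | requiredGain P α σ θ (fun i => X i ω, fun i => g i ω) <
        maxGain n fun i => h i ω} :=
      measurableSet_lt (hs.comp (hXm.prodMk hgm)) ((measurable_maxGain n).comp hhm)
    rw [← hind hm]
    rfl
  have hR : ∀ z, ∫ ω', D.indicator (fun _ => (1 : ℝ)) (fun i => h i ω', z) ∂μ =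
      ∑ k ∈ Finset.Icc 1 (n + 1), ((n + 1).choose k : ℝ) * (-1) ^ (k + 1) *
        Real.exp (-requiredGain P α σ θ z) ^ k := fun z => by
    have hm : MeasurableSet {ω | requiredGain P α σ θ z < maxGain n fun i => h i ω} :=
      measurableSet_lt measurable_const ((measurable_maxGain n).comp hhm)
    rw [← one_sub_one_sub_pow, ← hh.measureReal_lt_maxGain n (requiredGain_nonneg hP hθ z),
      ← hind hm]
    rfl
  simp only [hL, hR] at h1
  rw [h1, integral_finsetSum, Finset.mul_sum]
  · refine Finset.sum_congr rfl fun k hk => ?_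
    rw [integral_const_mul, integral_exp_requiredGain hlamb hP hα hθ hX hg hgX hfin
      (Finset.mem_Icc.1 hk).1]
    ring
  · intro k _
    refine Integrable.const_mul (Integrable.of_bound (((hs.comp (hXm.prodMk hgm)).neg.exp.pow_const
      k).aestronglyMeasurable) 1 (ae_of_all _ fun ω => ?_)) _
    have h0 := requiredGain_nonneg (σ := σ) (α := α) hP hθ (fun i => X i ω, fun i => g i ω)
    rw [Real.norm_of_nonneg (by positivity)]
    exact pow_le_one₀ (Real.exp_pos _).le (Real.exp_le_one_iff.2 (neg_nonpos.2 h0))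

end

end Cellular

end

/-! ### Summation over the number of users -/

theorem proposition1 {Ω : Type*} [MeasurableSpace Ω] (μ : Measure Ω) [IsProbabilityMeasure μ]
    (lamb lamu P α σ θ : ℝ) (hlamb : 0 < lamb) (hlamu : 0 < lamu) (hP : 0 < P) (hα : 2 < α)
    (hθ : 0 < θ)
    -- base stations, interference gains, gains and distances of the users of the cell,
    -- number of other users in the cell
    (X : ℕ → Ω → Cellular.Plane) (g h r : ℕ → Ω → ℝ) (N : Ω → ℕ)
    (hX : Cellular.IsHomogeneousPPP μ lamb X)
    (hg : Cellular.IsRayleigh μ g) (hh : Cellular.IsRayleigh μ h)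
    (hr : ∀ i, ∀ᵐ ω ∂μ, 0 < r i ω)
    (hN : Measurable N) (hNlaw : ∀ n, μ.real {ω | N ω = n} = Cellular.fN lamb lamu n)
    -- `X`, `g`, `h`, `N` are mutually independent
    (hgX : IndepFun (fun ω i => g i ω) (fun ω i => X i ω) μ)
    (hhXg : IndepFun (fun ω i => h i ω) (fun ω => (fun i => X i ω, fun i => g i ω)) μ)
    (hNXgh : IndepFun N (fun ω => (fun i => X i ω, fun i => g i ω, fun i => h i ω)) μ) :
    -- the interference series, the integrals and the series over `n` converge
    (∀ᵐ ω ∂μ, Summable fun i => g i ω * ‖X i ω‖ ^ (-α)) ∧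
    (∀ k : ℕ, 1 ≤ k →
      IntegrableOn (fun u : ℝ => 1 / (1 + u ^ (α / 2))) (Ioi ((k * θ) ^ (-2 / α))) ∧
      IntegrableOn (Cellular.covIntegrand lamb P α σ θ k) (Ioi 0)) ∧
    Summable (Cellular.covTerm lamb lamu P α σ θ) ∧
    -- the coverage probability
    μ.real {ω | Cellular.SINR P α σ (fun i => X i ω) (fun i => g i ω) (N ω)
        (fun i => r i ω) (fun i => h i ω) > θ} =
      Real.pi * lamb * ∑' n : ℕ, Cellular.covTerm lamb lamu P α σ θ n := by
  have hXm : Measurable fun ω i => X i ω := measurable_pi_lambda _ hX.measurable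
  have hgm : Measurable fun ω i => g i ω := measurable_pi_lambda _ hg.measurable
  have hhm : Measurable fun ω i => h i ω := measurable_pi_lambda _ hh.measurable
  have htop := Cellular.ae_tsum_ne_top hX hlamb.le hg hgX hα
  have hfin : ∀ᵐ ω ∂μ, Cellular.shotNoise α (fun i => X i ω, fun i => g i ω) ≠ ⊤ := by
    filter_upwards [htop] with ω hω using Cellular.shotNoise_ne_top hω
  set E : ℕ → Set Ω := fun n => {ω | N ω = n ∧
    Cellular.requiredGain P α σ θ (fun i => X i ω, fun i => g i ω) <
      Cellular.maxGain n fun i => h i ω}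
  have hlt : ∀ n, MeasurableSet {z : (ℕ → Cellular.Plane) × (ℕ → ℝ) × (ℕ → ℝ) |
      Cellular.requiredGain P α σ θ (z.1, z.2.1) < Cellular.maxGain n z.2.2} := fun n =>
    measurableSet_lt ((Cellular.measurable_requiredGain P α σ θ).comp
      (measurable_fst.prodMk (measurable_fst.comp measurable_snd)))
      ((Cellular.measurable_maxGain n).comp (measurable_snd.comp measurable_snd))
  have hEm : ∀ n, MeasurableSet (E n) := fun n =>
    (hN (measurableSet_singleton n)).inter ((hXm.prodMk (hgm.prodMk hhm)) (hlt n))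
  have hEd : Pairwise (Function.onFun Disjoint E) := fun i j hij =>
    Set.disjoint_left.2 fun ω h1 h2 => hij (h1.1.symm.trans h2.1)
  have hE : ∀ n, μ.real (E n) = Real.pi * lamb * Cellular.covTerm lamb lamu P α σ θ n := by
    intro n
    have h1 := hNXgh.measure_inter_preimage_eq_mul {n} _ (measurableSet_singleton n) (hlt n)
    have h2 : μ.real (E n) = μ.real {ω | N ω = n} *
        μ.real {ω | Cellular.requiredGain P α σ θ (fun i => X i ω, fun i => g i ω) <
          Cellular.maxGain n fun i => h i ω} := by
      rw [measureReal_def, measureReal_def, measureReal_def, ← ENNReal.toReal_mul]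
      exact congrArg ENNReal.toReal h1
    rw [h2, hNlaw, Cellular.measureReal_requiredGain_lt_maxGain hlamb hP hα hθ hX hg hh hgX hhXg
      hfin n, Cellular.covTerm]
    ring
  -- The alternating sums need no estimate: the terms are probabilities of disjoint events, so
  -- countable additivity gives convergence and value together.
  have hsum : HasSum (fun n => Real.pi * lamb * Cellular.covTerm lamb lamu P α σ θ n)
      (μ.real (⋃ n, E n)) := by
    have h1 := hasSum_integral_iUnion (f := fun _ => (1 : ℝ)) (μ := μ) hEm hEd
      (integrable_const _).integrableOn
    simpa [hE] using h1
  have hpl : Real.pi * lamb ≠ 0 := (mul_pos Real.pi_pos hlamb).ne'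
  refine ⟨?_, fun k hk => ⟨?_, ?_⟩, (summable_mul_left_iff hpl).1 hsum.summable, ?_⟩
  · filter_upwards [htop, hg.ae_pos] with ω hω hgω
    exact (ENNReal.summable_toReal hω).congr fun i =>
      ENNReal.toReal_ofReal (mul_nonneg (hgω i).le (by positivity))
  · refine Cellular.integrableOn_one_div_one_add_rpow hα (Real.rpow_pos_of_pos ?_ _)
    exact mul_pos (by exact_mod_cast hk) hθ
  · exact Cellular.integrableOn_covIntegrand hP hα hθ k hlamb
  · rw [← tsum_mul_left, hsum.tsum_eq]
    -- The SINR event involves `r`, known only to be almost surely positive; it agrees almost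
    -- everywhere with the union of the measurable `E n`, which are free of `r`.
    refine measureReal_congr ?_
    filter_upwards [hfin, hg.ae_pos, ae_all_iff.2 hr, hX.ae_nearestDist_pos hlamb.le,
      hX.ae_exists_le_norm hlamb] with ω h1 h2 h3 h4 h5
    have h6 := Cellular.SINR_gt_iff (σ := σ) (θ := θ) (n := N ω) (h := fun i => h i ω) hP
      (fun i => (h2 i).le) h3 h4 (ENNReal.toReal_pos (Cellular.shotNoise_ne_zero h2 h5) h1)
    refine propext (h6.trans ?_)
    constructor
    · exact fun h => Set.mem_iUnion.2 ⟨N ω, rfl, h⟩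
    · intro h
      obtain ⟨n, hn, h⟩ := Set.mem_iUnion.1 h
      exact hn ▸ h
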